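/- Let $a>0$, $0\le b<1$, $\beta\ge 0$, let $\Gamma$ be a compact metric space with its Borel $\sigma$-algebra, and let $\mu$ be a Borel probability measure on $\Gamma$. Let $\mathcal H$ be the set of finite integer-valued measures (configurations) $\xi=\sum_{i=1}^n\delta_{x_i}$ on $\Gamma$, with total mass $|\xi|=n$, equipped with the smallest $\sigma$-algebra that makes $\xi\mapsto\xi(C)$ measurable for all Borel sets $C\subset\Gamma$. The birth-death process on $\mathbb Z_+$ with birth rates $\alpha_k=a+bk$ and death rates $\beta_k=k+\beta k(k-1)$ has a unique invariant distribution $\pi_{a,b;\beta}$. Let $\boldsymbol\pi$ (the polynomial birth-death point process distribution, PBDP) be the law of $\sum_{i=1}^{Z}\delta_{U_i}$, where $Z\sim\pi_{a,b;\beta}$ and $U_1,U_2,\dots$ are independent with law $\mu$ and independent of $Z$. For $h:\mathcal H\to\mathbb R$ put $$\mathcal A h(\xi)=(a+b|\xi|)\int_\Gamma\big(h(\xi+\delta_x)-h(\xi)\big)\,\mu(dx)+\big(1+\beta(|\xi|-1)\big)\int_\Gamma\big(h(\xi-\delta_x)-h(\xi)\big)\,\xi(dx),$$ and let $\mathbf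 Z_\xi=\{\mathbf Z_\xi(t):t\ge 0\}$ be the birth-death system with generator $\mathcal A$ started at $\xi\in\mathcal H$, that is, the pure jump Markov process on $\mathcal H$ in which, in state $\eta$, a new particle is added with rate $a+b|\eta|$ at a site with law $\mu$, and each particle of $\eta$ is removed with rate $1+\beta(|\eta|-1)$. Then for every bounded measurable $f:\mathcal H\to\mathbb R$ the function $$h_f(\xi):=-\int_0^\infty\big(\mathbb E f(\mathbf Z_\xi(t))-\boldsymbol\pi(f)\big)\,dt,\qquad \boldsymbol\pi(f)=\int f\,d\boldsymbol\pi,$$ is well defined: for every $\xi\in\mathcal H$ the integrand is Lebesgue integrable over $(0,\infty)$. Moreover $h_f$ is measurable, $x\mapsto h_f(\xi+\delta_x)$ is $\mu$-integrable for every $\xi$, and $h_f$ solves the Stein equation $$\mathcal A h_f(\xi)=f(\xi)-\boldsymbol\pi(f)\qquad\text{for all }\xi\in\mathcal H.$$ -/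

import Mathlib

open MeasureTheory ProbabilityTheory Set
open scoped ENNReal

noncomputable section

namespace PBDP

/-! ### Pure jump Markov processes -/

section PureJump

variable {S : Type*} [MeasurableSpace S]

/-- The jump law of the pure jump process with rate kernel `Q`: from `x` the process jumps
according to `Q x / Q x univ`. (States without finite positive total rate are made absorbing.) -/
def jumpKernel (Q : Kernel S S) : Kernel S S where
  toFun := by
    classical
    exact fun x => if Q x univ = 0 ∨ Q x univ = ∞ then Measure.dirac x else (Q x univ)⁻¹ • Q x
  measurable' := by
    classical
    have hq : Measurable fun x => Q x univ := Q.measurable_coe MeasurableSet.univ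
    refine Measurable.ite ?_ Measure.measurable_dirac ?_
    · exact (hq (measurableSet_singleton 0)).union (hq (measurableSet_singleton ∞))
    · refine Measure.measurable_of_measurable_coe _ fun A hA => ?_
      simp only [Measure.smul_apply, smul_eq_mul]
      exact hq.inv.mul (Q.measurable_coe hA)

instance (Q : Kernel S S) : IsMarkovKernel (jumpKernel Q) := by
  classical
  refine ⟨fun x => ?_⟩
  change IsProbabilityMeasure
    (if Q x univ = 0 ∨ Q x univ = ∞ then Measure.dirac x else (Q x univ)⁻¹ • Q x)
  split_ifs with h
  · infer_instance
  · push Not at h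
    exact ⟨by simpa using ENNReal.inv_mul_cancel h.1 h.2⟩

/-- The law on `ℕ → S` of the Markov chain started at `x` with transition kernel
`jumpKernel Q`. -/
def jumpChain (Q : Kernel S S) (x : S) : Measure (ℕ → S) :=
  Kernel.trajMeasure (X := fun _ => S) (Measure.dirac x) fun n =>
    (jumpKernel Q).comap (fun p : (Finset.Iic n → S) => p ⟨n, Finset.mem_Iic.2 le_rfl⟩)
      (measurable_pi_apply _)

/-- The law, for the process started at `x`, of the pair consisting of the chain of visited states
and an independent sequence of independent standard exponential variables. -/
def pathLaw (Q : Kernel S S) (x : S) : Measure ((ℕ → S) × (ℕ → ℝ)) :=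
  (jumpChain Q x).prod (Measure.infinitePi fun _ : ℕ => expMeasure 1)

/-- The time of the `n`-th jump (`0` for `n = 0`): the sojourn in the `i`-th visited state `y i` is
`e i / Q (y i) univ`, so that it is exponential with parameter `Q (y i) univ`. -/
def jumpTime (Q : Kernel S S) (ω : (ℕ → S) × (ℕ → ℝ)) (n : ℕ) : ℝ≥0∞ :=
  ∑ i ∈ Finset.range n, ENNReal.ofReal (ω.2 i) / Q (ω.1 i) univ

/-- The state at time `t` of the pure jump process with rate kernel `Q`: the `n`-th visited state,
where `jumpTime n ≤ t < jumpTime (n + 1)`. -/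
def process (Q : Kernel S S) (t : ℝ) (ω : (ℕ → S) × (ℕ → ℝ)) : S :=
  ω.1 (sInf {n : ℕ | ENNReal.ofReal t < jumpTime Q ω (n + 1)})

/-- `π` is an invariant distribution of the pure jump process with rate kernel `Q`: if the initial
state has law `π`, then so has the state at every time `t`. -/
def IsInvariantDistribution (Q : Kernel S S) (π : Measure S) : Prop :=
  IsProbabilityMeasure π ∧ ∀ t : ℝ, 0 ≤ t → ∀ A : Set S, MeasurableSet A →
    ∫⁻ x, pathLaw Q x {ω | process Q t ω ∈ A} ∂π = π A

end PureJump

/-- The rates of the birth-death process on `ℕ` with birth rates `a + b k` and death rates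
`k + β k (k - 1)`. -/
def birthDeathRates (a b β : ℝ) : Kernel ℕ ℕ where
  toFun k := ENNReal.ofReal (a + b * k) • Measure.dirac (k + 1) +
    ENNReal.ofReal (k + β * k * (k - 1)) • Measure.dirac (k - 1)
  measurable' := Measurable.of_discrete

/-! ### Configurations -/

section Configuration

variable {Γ : Type*} [MeasurableSpace Γ]

open Classical in
/-- The number `ξ(C)` of points of the configuration `ξ` in `C`. -/
def countIn (C : Set Γ) (ξ : Multiset Γ) : ℕ := ξ.countP (· ∈ C)

/-- The configuration `δ_{x_1} + ⋯ + δ_{x_n}` is the multiset of the points `x_1, …, x_n`. The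
σ-algebra on configurations is the smallest one that makes all `ξ ↦ ξ(C)`, `C` measurable,
measurable. -/
instance : MeasurableSpace (Multiset Γ) :=
  ⨆ C ∈ {C : Set Γ | MeasurableSet C}, MeasurableSpace.comap (countIn C) ⊤

theorem measurable_countIn {C : Set Γ} (hC : MeasurableSet C) : Measurable (countIn C) :=
  Measurable.of_comap_le
    (le_iSup₂_of_le (f := fun (C : Set Γ) (_ : C ∈ {C : Set Γ | MeasurableSet C}) =>
      MeasurableSpace.comap (countIn C) ⊤) C hC le_rfl)

theorem measurable_to_multiset {T : Type*} [MeasurableSpace T] {g : T → Multiset Γ}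
    (h : ∀ C : Set Γ, MeasurableSet C → Measurable fun t => countIn C (g t)) : Measurable g := by
  refine Measurable.of_le_map (iSup₂_le fun C hC => ?_)
  rintro _ ⟨B, -, rfl⟩
  exact h C hC (MeasurableSet.of_discrete (s := B))

theorem measurable_card : Measurable (Multiset.card : Multiset Γ → ℕ) := by
  have h : (Multiset.card : Multiset Γ → ℕ) = countIn univ := by
    ext ξ
    simp [countIn]
  rw [h]
  exact measurable_countIn MeasurableSet.univ

open Classical in
theorem measurable_cons :
    Measurable fun p : Multiset Γ × Γ => p.2 ::ₘ p.1 := by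
  refine measurable_to_multiset fun C hC => ?_
  simp only [countIn, Multiset.countP_cons]
  refine Measurable.add ((measurable_countIn hC).comp measurable_fst) ?_
  exact Measurable.ite (measurable_snd hC) measurable_const measurable_const

open Classical in
/-- The measure `∑_{x ∈ ξ} δ_{ξ - δ_x}`: each particle of `ξ` is removed with rate `1`. -/
def deathMeasure (ξ : Multiset Γ) : Measure (Multiset Γ) :=
  (ξ.map fun x => Measure.dirac (ξ.erase x)).sum

open Classical in
theorem deathMeasure_apply (ξ : Multiset Γ) {A : Set (Multiset Γ)} (hA : MeasurableSet A) :
    deathMeasure ξ A = (ξ.map fun x => A.indicator (1 : Multiset Γ → ℝ≥0∞) (ξ.erase x)).sum := by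
  have key : ∀ s : Multiset Γ, (s.map fun x => Measure.dirac (ξ.erase x)).sum A =
      (s.map fun x => A.indicator (1 : Multiset Γ → ℝ≥0∞) (ξ.erase x)).sum := by
    intro s
    induction s using Multiset.induction_on with
    | empty => simp
    | cons x s ih => simp [ih, Measure.dirac_apply' _ hA]
  exact key ξ

theorem deathMeasure_univ (ξ : Multiset Γ) : deathMeasure ξ univ = (Multiset.card ξ : ℝ≥0∞) := by
  classical
  rw [deathMeasure_apply ξ MeasurableSet.univ]
  simp

instance (ξ : Multiset Γ) : IsFiniteMeasure (deathMeasure ξ) :=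
  ⟨by rw [deathMeasure_univ]; exact ENNReal.natCast_lt_top _⟩

theorem measurable_deathMeasure : Measurable (deathMeasure : Multiset Γ → Measure _) := by
  classical
  refine Measurable.measure_of_isPiSystem
    (generateFrom_piiUnionInter_measurableSet
      (fun C : Set Γ => MeasurableSpace.comap (countIn C) ⊤) {C | MeasurableSet C}).symm
    (isPiSystem_piiUnionInter _
      (fun C => @MeasurableSpace.isPiSystem_measurableSet _
        (MeasurableSpace.comap (countIn C) ⊤)) _) ?_ ?_
  · rintro A ⟨F, hF, g, hg, rfl⟩
    have hB : ∀ C : Set Γ, ∃ B : Set ℕ, C ∈ F → countIn C ⁻¹' B = g C := by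
      intro C
      by_cases hC : C ∈ F
      · obtain ⟨B, -, hB⟩ := hg C hC
        exact ⟨B, fun _ => hB⟩
      · exact ⟨∅, fun h => absurd h hC⟩
    choose B hB using hB
    -- the set of members of `F` that contain `x`
    let sig : Γ → Finset (Set Γ) := fun x => F.filter (x ∈ ·)
    have hsig : ∀ T : Finset (Set Γ), MeasurableSet {x | sig x = T} := by
      intro T
      by_cases hT : T ⊆ F
      · have : {x | sig x = T} = ⋂ C ∈ F, (if C ∈ T then C else Cᶜ) := by
          ext x
          simp only [mem_ofPred_eq, mem_iInter, sig, Finset.ext_iff, Finset.mem_filter]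
          constructor
          · intro h C hC
            split_ifs with hCT
            · exact ((h C).2 hCT).2
            · exact fun hx => hCT ((h C).1 ⟨hC, hx⟩)
          · intro h C
            constructor
            · rintro ⟨hC, hx⟩
              have := h C hC
              by_contra hCT
              rw [if_neg hCT] at this
              exact this hx
            · intro hCT
              have := h C (hT hCT)
              rw [if_pos hCT] at this
              exact ⟨hT hCT, this⟩
        rw [this]
        refine Finset.measurableSet_biInter _ fun C hC => ?_
        split_ifs
        · exact hF hC
        · exact (hF hC : MeasurableSet C).compl
      · have : {x | sig x = T} = ∅ := by
          ext x
          simp only [mem_ofPred_eq, mem_empty_iff_false, iff_false]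
          rintro rfl
          exact hT (Finset.filter_subset _ _)
        rw [this]
        exact MeasurableSet.empty
    -- the event that removing a particle of type `T` leads to the given set
    let D : Finset (Set Γ) → Set (Multiset Γ) := fun T =>
      {ξ | ∀ C ∈ F, countIn C ξ - (if C ∈ T then 1 else 0) ∈ B C}
    have hD : ∀ T, MeasurableSet (D T) := by
      intro T
      have : D T = ⋂ C ∈ F, countIn C ⁻¹' {k | k - (if C ∈ T then 1 else 0) ∈ B C} := by
        ext ξ
        simp [D]
      rw [this]
      exact Finset.measurableSet_biInter _ fun C hC =>
        measurable_countIn (hF hC) MeasurableSet.of_discrete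
    have hA : MeasurableSet (⋂ C ∈ F, g C) := by
      refine Finset.measurableSet_biInter _ fun C hC => ?_
      rw [← hB C hC]
      exact measurable_countIn (hF hC) MeasurableSet.of_discrete
    have hmem : ∀ (ξ : Multiset Γ) (x : Γ), x ∈ ξ →
        ((ξ.erase x ∈ ⋂ C ∈ F, g C) ↔ ξ ∈ D (sig x)) := by
      intro ξ x hx
      simp only [mem_iInter, D, mem_ofPred_eq]
      refine forall₂_congr fun C hC => ?_
      rw [← hB C hC, mem_preimage]
      have h1 : countIn C (ξ.erase x) = countIn C ξ - (if C ∈ sig x then 1 else 0) := by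
        have h2 : countIn C ξ = countIn C (ξ.erase x) + if x ∈ C then 1 else 0 := by
          conv_lhs => rw [← Multiset.cons_erase hx]
          simp only [countIn, Multiset.countP_cons]
        have h3 : C ∈ sig x ↔ x ∈ C := by simp [sig, hC]
        rw [h2]
        simp [h3]
      rw [h1]
    have hsum : (fun ξ : Multiset Γ => deathMeasure ξ (⋂ C ∈ F, g C)) = fun ξ =>
        ∑ T ∈ F.powerset, (countIn {x | sig x = T} ξ : ℝ≥0∞) *
          (D T).indicator (1 : Multiset Γ → ℝ≥0∞) ξ := by
      ext ξ
      rw [deathMeasure_apply ξ hA]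
      have key : ∀ s : Multiset Γ,
          (s.map fun x => (D (sig x)).indicator (1 : Multiset Γ → ℝ≥0∞) ξ).sum =
          ∑ T ∈ F.powerset, (countIn {x | sig x = T} s : ℝ≥0∞) *
            (D T).indicator (1 : Multiset Γ → ℝ≥0∞) ξ := by
        intro s
        induction s using Multiset.induction_on with
        | empty => simp [countIn]
        | cons x s ih =>
          rw [Multiset.map_cons, Multiset.sum_cons, ih]
          have h4 : (D (sig x)).indicator (1 : Multiset Γ → ℝ≥0∞) ξ =
              ∑ T ∈ F.powerset, (if sig x = T then 1 else 0) *
                (D T).indicator (1 : Multiset Γ → ℝ≥0∞) ξ := by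
            rw [Finset.sum_eq_single (sig x)]
            · simp
            · intro T _ hT
              simp [hT.symm]
            · intro h
              exact absurd (Finset.mem_powerset.2 (Finset.filter_subset _ _)) h
          rw [h4, ← Finset.sum_add_distrib]
          refine Finset.sum_congr rfl fun T _ => ?_
          rw [← add_mul]
          congr 1
          simp only [countIn, Multiset.countP_cons, mem_ofPred_eq]
          push_cast
          rw [add_comm]
      rw [← key ξ]
      congr 1
      refine Multiset.map_congr rfl fun x hx => ?_
      by_cases h : ξ ∈ D (sig x)
      · rw [indicator_of_mem h, indicator_of_mem ((hmem ξ x hx).2 h)]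
        rfl
      · rw [indicator_of_notMem h, indicator_of_notMem fun h' => h ((hmem ξ x hx).1 h')]
    rw [hsum]
    refine Finset.measurable_sum _ fun T _ => Measurable.mul ?_ ?_
    · exact (Measurable.of_discrete (f := fun n : ℕ => (n : ℝ≥0∞))).comp
        (measurable_countIn (hsig T))
    · exact measurable_one.indicator (hD T)
  · simp only [deathMeasure_univ]
    exact (Measurable.of_discrete (f := fun n : ℕ => (n : ℝ≥0∞))).comp measurable_card

/-- The rates of the birth-death system on configurations. With rate `a + b |ξ|` a new particle is
added at a site with law `μ`, and each of the particles of `ξ` is removed with rate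
`1 + β (|ξ| - 1)`. -/
def systemRates (a b β : ℝ) (μ : Measure Γ) [IsProbabilityMeasure μ] :
    Kernel (Multiset Γ) (Multiset Γ) where
  toFun ξ := ENNReal.ofReal (a + b * Multiset.card ξ) • μ.map (fun x => x ::ₘ ξ) +
    ENNReal.ofReal (1 + β * (Multiset.card ξ - 1)) • deathMeasure ξ
  measurable' := by
    refine Measure.measurable_of_measurable_coe _ fun A hA => ?_
    simp only [Measure.add_apply, Measure.smul_apply, smul_eq_mul]
    refine Measurable.add (Measurable.mul ?_ ?_) (Measurable.mul ?_ ?_)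
    · exact (Measurable.of_discrete (f := fun n : ℕ => ENNReal.ofReal (a + b * n))).comp
        measurable_card
    · have h : ∀ ξ : Multiset Γ, μ.map (fun x => x ::ₘ ξ) A =
          μ (Prod.mk ξ ⁻¹' ((fun p : Multiset Γ × Γ => p.2 ::ₘ p.1) ⁻¹' A)) := fun ξ =>
        Measure.map_apply (measurable_cons.comp measurable_prodMk_left) hA
      simp only [h]
      exact measurable_measure_prodMk_left (measurable_cons hA)
    · exact (Measurable.of_discrete (f := fun n : ℕ => ENNReal.ofReal (1 + β * (n - 1)))).comp
        measurable_card
    · exact (Measure.measurable_coe hA).comp measurable_deathMeasure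

/-- The law of `∑_{i=1}^Z δ_{U_i}`, where `Z` has law `π` and `U_1, U_2, …` are independent with
law `μ` and independent of `Z`. -/
def pointProcessLaw (π : Measure ℕ) (μ : Measure Γ) : Measure (Multiset Γ) :=
  (π.prod (Measure.infinitePi fun _ : ℕ => μ)).map
    fun p : ℕ × (ℕ → Γ) => (Multiset.range p.1).map p.2

/-- The map in the definition of `pointProcessLaw` is measurable. -/
theorem measurable_pointProcess :
    Measurable fun p : ℕ × (ℕ → Γ) => (Multiset.range p.1).map p.2 := by
  classical
  refine measurable_from_prod_countable_right fun n => ?_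
  induction n with
  | zero => simp
  | succ n ih =>
    simp only [Multiset.range_succ, Multiset.map_cons]
    exact measurable_cons.comp (ih.prodMk (measurable_pi_apply n))

open Classical in
/-- The generator of the birth-death system; the integral with respect to `ξ` is the sum over the
points of `ξ`. -/
def generator (a b β : ℝ) (μ : Measure Γ) (h : Multiset Γ → ℝ) (ξ : Multiset Γ) : ℝ :=
  (a + b * Multiset.card ξ) * ∫ x, (h (x ::ₘ ξ) - h ξ) ∂μ +
    (1 + β * (Multiset.card ξ - 1)) * (ξ.map fun x => h (ξ.erase x) - h ξ).sum

/-- `E f(Z_ξ(t))` for the birth-death system `Z_ξ` started at `ξ`. -/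
def expectation (a b β : ℝ) (μ : Measure Γ) [IsProbabilityMeasure μ] (f : Multiset Γ → ℝ)
    (ξ : Multiset Γ) (t : ℝ) : ℝ :=
  ∫ ω, f (process (systemRates a b β μ) t ω) ∂pathLaw (systemRates a b β μ) ξ

/-- `h_f(ξ) = - ∫_0^∞ (E f(Z_ξ(t)) - ∫ f dP) dt` for a law `P` on configurations. -/
def steinSolution (a b β : ℝ) (μ : Measure Γ) [IsProbabilityMeasure μ] (P : Measure (Multiset Γ))
    (f : Multiset Γ → ℝ) (ξ : Multiset Γ) : ℝ :=
  -∫ t in Ioi (0 : ℝ), (expectation a b β μ f ξ t - ∫ η, f η ∂P)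

end Configuration

end PBDP

end

/-! Write P_t f(x) = E f(Z_x(t)). If P_t f(x) - π(f) is integrable over (0, ∞), then integrating the
backward equation d/dt P_t f = A P_t f over (0, ∞) gives A h_f = -∫ A P_t f dt = f - lim P_t f = f -
π(f). The work lies in justifying the backward equation, the integrability and the limit for
unbounded rates.

Everything except the identification of the equilibrium is done for an abstract kernel whose states
have a size evolving as the birth-death process (`IsBirthDeath`). This treats the process on ℕ and
the system on configurations at once.

The path splits at its first jump (`pathLaw_eq_map`). Together with non-explosion
(`ae_lifetime_eq_top`) this gives the backward equation, first integrated (`semigroup_eq`), then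
differential (`hasDerivAt_semigroup`). Non-explosion follows from a maximum principle for E exp(-c
ζ), with ζ the lifetime and 1 + size as comparison function.

Integrability comes from two independent copies run until both are empty, used only through their
product generator, so that no coupled process is constructed. The gap P_t f(x) - P_t f(y) satisfies
a linear equation whose absolute integral is controlled by `mul_integral_abs_le`. A Lyapunov
function of the total size with drift at most -1 away from the empty pair then bounds the integrated
gap by a constant times the total size, uniformly in the time horizon (`totalGap_le_size`).

The weights given by detailed balance define an equilibrium on ℕ. Placing that many independent
points gives a law balanced for the system (`isBalanced_pointProcessLaw`), and balanced laws with
integrable total rate are invariant (`integral_semigroup_eq`). Averaging the gap bound over this law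
gives integrability of P_t f(x) - π(f). Its derivative is integrable too, so it tends to 0. This
yields the Poisson equation (`totalRate_mul_potential`) and also uniqueness of the invariant
distribution. -/

noncomputable section

namespace PBDP

/-! ### Laws on sequence spaces -/

section Sequences

variable {S : Type*}

/-- The sequence `x, y 0, y 1, …`. -/
def seqCons (x : S) (y : ℕ → S) : ℕ → S := fun n => Nat.casesOn n x y

variable [MeasurableSpace S]

theorem measurable_seqCons : Measurable fun p : S × (ℕ → S) => seqCons p.1 p.2 := by
  refine measurable_pi_lambda _ fun n => ?_
  cases n with
  | zero => exact measurable_fst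
  | succ n => exact (measurable_pi_apply n).comp measurable_snd

theorem measurableSet_forall_lt_mem (n : ℕ) {A : ℕ → Set S} (hA : ∀ i, MeasurableSet (A i)) :
    MeasurableSet {y : ℕ → S | ∀ i < n, y i ∈ A i} := by
  simp only [ofPred_forall]
  exact MeasurableSet.iInter fun i => MeasurableSet.iInter fun _ => measurable_pi_apply i (hA i)

/-- A finite measure on sequences is determined by the probabilities of finite-dimensional
rectangles. -/
theorem measure_seq_ext {P P' : Measure (ℕ → S)} [IsFiniteMeasure P]
    (h : ∀ (n : ℕ) (A : ℕ → Set S), (∀ i, MeasurableSet (A i)) →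
      P {y | ∀ i < n, y i ∈ A i} = P' {y | ∀ i < n, y i ∈ A i}) : P = P' := by
  classical
  refine ext_of_generate_finite _ (generateFrom_squareCylinders (α := fun _ : ℕ => S)).symm
    (isPiSystem_squareCylinders (fun _ => MeasurableSpace.isPiSystem_measurableSet)
      fun _ => MeasurableSet.univ) ?_ ?_
  · rintro _ ⟨s, t, ht, rfl⟩
    -- A cylinder over a finite index set becomes a rectangle over an initial segment once the
    -- missing coordinates are left free.
    have key := h (s.sup id + 1) (fun i => if i ∈ s then t i else univ) fun i => by
      split_ifs
      · exact ht i (mem_univ i)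
      · exact MeasurableSet.univ
    have hset : {y : ℕ → S | ∀ i < s.sup id + 1, y i ∈ if i ∈ s then t i else univ} =
        (s : Set ℕ).pi t := by
      ext y
      simp only [mem_ofPred_eq, Set.mem_pi, Finset.mem_coe]
      constructor
      · intro hy i hi
        have := hy i (Nat.lt_succ_of_le (Finset.le_sup (f := id) hi))
        rwa [if_pos hi] at this
      · intro hy i _
        split_ifs with hi
        · exact hy i hi
        · exact mem_univ _
    rwa [hset] at key
  -- The rectangle with no constraints is the whole space, so the total masses agree.
  · simpa using h 0 (fun _ => univ) fun _ => MeasurableSet.univ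

/-- A sequence of independent variables with a common law is a variable with this law, followed by
an independent such sequence. -/
theorem infinitePi_eq_map_seqCons (μ : Measure S) [IsProbabilityMeasure μ] :
    (Measure.infinitePi fun _ : ℕ => μ) =
      (μ.prod (Measure.infinitePi fun _ : ℕ => μ)).map fun p => seqCons p.1 p.2 := by
  have hpi : ∀ (n : ℕ) (A : ℕ → Set S), (∀ i, MeasurableSet (A i)) →
      (Measure.infinitePi fun _ : ℕ => μ) {y | ∀ i < n, y i ∈ A i} =
        ∏ i ∈ Finset.range n, μ (A i) := fun n A hA => by
    rw [← Measure.infinitePi_pi (μ := fun _ : ℕ => μ) fun i _ => hA i]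
    congr 1
    ext y
    simp
  refine measure_seq_ext fun n A hA => ?_
  rw [hpi n A hA, Measure.map_apply measurable_seqCons (measurableSet_forall_lt_mem n hA)]
  cases n with
  | zero => simp
  | succ n =>
    have hset : (fun p : S × (ℕ → S) => seqCons p.1 p.2) ⁻¹' {y | ∀ i < n + 1, y i ∈ A i} =
        A 0 ×ˢ {y | ∀ i < n, y i ∈ A (i + 1)} := by
      ext p
      simp only [mem_preimage, mem_ofPred_eq, mem_prod]
      constructor
      · intro h
        exact ⟨h 0 (Nat.succ_pos n), fun i hi => h (i + 1) (Nat.succ_lt_succ hi)⟩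
      · rintro ⟨h0, h1⟩ i hi
        cases i with
        | zero => exact h0
        | succ i => exact h1 i (Nat.lt_of_succ_lt_succ hi)
    rw [hset, Measure.prod_prod, hpi n _ fun i => hA (i + 1), Finset.prod_range_succ', mul_comm]

end Sequences

/-! ### Markov property at the first jump -/

section PathLaw

variable {S : Type*} [MeasurableSpace S] (Q : Kernel S S)

instance : IsProbabilityMeasure (expMeasure 1) := isProbabilityMeasure_expMeasure one_pos

instance (x : S) : IsProbabilityMeasure (jumpChain Q x) := by
  unfold jumpChain
  infer_instance

instance (x : S) : IsProbabilityMeasure (pathLaw Q x) := by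
  unfold pathLaw
  infer_instance

theorem measurable_jumpChain : Measurable (jumpChain Q) := by
  unfold jumpChain Kernel.trajMeasure
  have h : Measurable fun x : S => (Measure.dirac x).map
      (MeasurableEquiv.piUnique (fun _ : Finset.Iic 0 => S)).symm := by
    refine (Measure.measurable_map _ ?_).comp Measure.measurable_dirac
    exact MeasurableEquiv.measurable _
  exact (Measure.measurable_bind' (Kernel.measurable _)).comp h

theorem jumpChain_map_zero (x : S) : (jumpChain Q x).map (fun y => y 0) = Measure.dirac x := by
  unfold jumpChain Kernel.trajMeasure
  rw [Measure.map_dirac' (MeasurableEquiv.measurable _), Measure.dirac_bind (Kernel.measurable _)]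
  have h : (fun y : ℕ → S => y 0) = (fun p : Finset.Iic 0 → S => p ⟨0, Finset.mem_Iic.2 le_rfl⟩) ∘
      Preorder.frestrictLe (π := fun _ => S) 0 := rfl
  rw [h, ← Measure.map_map (measurable_pi_apply _) (by fun_prop),
    Kernel.traj_map_frestrictLe_apply, Kernel.partialTraj_self, Kernel.id_apply,
    Measure.map_dirac' (measurable_pi_apply _)]
  rfl

/-- The trajectory measure is built by appending the next state with the jump kernel; here the last
coordinate is integrated out. -/
theorem lintegral_jumpChain_succ (x : S) (n : ℕ) {g : ℕ → S → ℝ≥0∞} (hg : ∀ i, Measurable (g i)) :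
    ∫⁻ y, ∏ i ∈ Finset.range (n + 2), g i (y i) ∂jumpChain Q x =
      ∫⁻ y, (∏ i ∈ Finset.range (n + 1), g i (y i)) * ∫⁻ z, g (n + 1) z ∂jumpKernel Q (y n)
        ∂jumpChain Q x := by
  have key := Kernel.map_frestrictLe_trajMeasure_compProd_eq_map_trajMeasure (X := fun _ => S)
    (μ₀ := Measure.dirac x) (κ := fun n =>
    (jumpKernel Q).comap (fun p : (Finset.Iic n → S) => p ⟨n, Finset.mem_Iic.2 le_rfl⟩)
      (measurable_pi_apply _)) (a := n)
  have hF : Measurable fun p : (Finset.Iic n → S) × S =>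
      (∏ i : Finset.Iic n, g i (p.1 i)) * g (n + 1) p.2 := by
    refine Measurable.mul ?_ ((hg _).comp measurable_snd)
    exact Finset.measurable_prod _ fun i _ =>
      (hg i).comp ((measurable_pi_apply i).comp measurable_fst)
  have h2 := congrArg (fun ν => ∫⁻ p, (∏ i : Finset.Iic n, g i (p.1 i)) * g (n + 1) p.2 ∂ν) key
  rw [Measure.lintegral_compProd hF, lintegral_map hF.lintegral_kernel_prod_right' (by fun_prop),
    lintegral_map hF (by fun_prop)] at h2
  have hprod : ∀ y : ℕ → S, ∏ i : Finset.Iic n, g i (Preorder.frestrictLe (π := fun _ => S) n y i) =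
      ∏ i ∈ Finset.range (n + 1), g i (y i) := by
    intro y
    have : Finset.range (n + 1) = Finset.Iic n := by ext; simp
    rw [this]
    exact Finset.prod_coe_sort (Finset.Iic n) fun i => g i (y i)
  simp only [hprod] at h2
  simp only [Finset.prod_range_succ _ (n + 1)]
  unfold jumpChain
  rw [← h2]
  refine lintegral_congr fun y => ?_
  rw [lintegral_const_mul _ (hg _)]
  rfl

theorem lintegral_jumpChain_zero (x : S) {g : S → ℝ≥0∞} (hg : Measurable g) :
    ∫⁻ y, g (y 0) ∂jumpChain Q x = g x := by
  rw [← lintegral_dirac' x hg, ← jumpChain_map_zero Q x, lintegral_map hg (measurable_pi_apply 0)]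

/-- The construction of the chain conditions on the past, whereas the backward equation needs
conditioning on the first step. Product functionals allow the passage between the two, by repeatedly
removing the last coordinate. -/
theorem lintegral_prod_jumpChain (n : ℕ) (x : S) {g : ℕ → S → ℝ≥0∞}
    (hg : ∀ i, Measurable (g i)) :
    ∫⁻ y, ∏ i ∈ Finset.range (n + 1), g i (y i) ∂jumpChain Q x =
      g 0 x * ∫⁻ z, ∫⁻ y, ∏ i ∈ Finset.range n, g (i + 1) (y i) ∂jumpChain Q z
        ∂jumpKernel Q x := by
  induction n generalizing g with
  | zero =>
    simp only [zero_add, Finset.range_one, Finset.prod_singleton, Finset.range_zero,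
      Finset.prod_empty, lintegral_const, measure_univ, mul_one]
    exact lintegral_jumpChain_zero Q x (hg 0)
  | succ n ih =>
    rw [lintegral_jumpChain_succ Q x n hg]
    have hJ : Measurable fun w => ∫⁻ z, g (n + 1) z ∂jumpKernel Q w := (hg _).lintegral_kernel
    -- The integrated last factor depends only on the state at index `n`, so it is absorbed into the
    -- factor there and the induction hypothesis applies to a shorter product.
    let g' : ℕ → S → ℝ≥0∞ := Function.update g n fun w => g n w * ∫⁻ z, g (n + 1) z ∂jumpKernel Q w
    have hg' : ∀ i, Measurable (g' i) := by
      intro i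
      by_cases hi : i = n
      · subst hi
        simp only [g', Function.update_self]
        exact (hg i).mul hJ
      · simpa [g', Function.update_of_ne hi] using hg i
    have hne : ∀ i, i ≠ n → g' i = g i := fun i hi => Function.update_of_ne hi _ _
    have hn : ∀ w, g' n w = g n w * ∫⁻ z, g (n + 1) z ∂jumpKernel Q w := fun w => by simp [g']
    have h1 : ∀ y : ℕ → S, (∏ i ∈ Finset.range (n + 1), g i (y i)) *
        ∫⁻ z, g (n + 1) z ∂jumpKernel Q (y n) = ∏ i ∈ Finset.range (n + 1), g' i (y i) := by
      intro y
      rw [Finset.prod_range_succ, Finset.prod_range_succ, hn, mul_assoc]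
      congr 1
      exact Finset.prod_congr rfl fun i hi => by rw [hne i (Finset.mem_range.1 hi).ne]
    simp only [h1]
    rw [ih hg']
    cases n with
    | zero =>
      simp only [hn, Finset.range_zero, Finset.prod_empty, lintegral_const, measure_univ, mul_one,
        zero_add, Finset.range_one, Finset.prod_singleton]
      congr 1
      exact lintegral_congr fun z => (lintegral_jumpChain_zero Q z (hg 1)).symm
    | succ n =>
      rw [hne 0 (Nat.succ_ne_zero n).symm]
      congr 1
      refine lintegral_congr fun z => ?_
      rw [lintegral_jumpChain_succ Q z n fun i => hg (i + 1)]
      refine lintegral_congr fun y => ?_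
      rw [Finset.prod_range_succ, Finset.prod_range_succ, hn, mul_assoc]
      congr 1
      exact Finset.prod_congr rfl fun i hi => by
        rw [hne _ (by have := Finset.mem_range.1 hi; omega)]

/-- The Markov property of the chain of visited states at time `1`. -/
theorem jumpChain_eq_map_bind (x : S) :
    jumpChain Q x = ((jumpKernel Q x).bind (jumpChain Q)).map (seqCons x) := by
  classical
  have hc : Measurable (seqCons x) := measurable_seqCons.comp measurable_prodMk_left
  refine measure_seq_ext fun n A hA => ?_
  rw [Measure.map_apply hc (measurableSet_forall_lt_mem n hA),
    Measure.bind_apply (hc (measurableSet_forall_lt_mem n hA)) (measurable_jumpChain Q).aemeasurable]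
  cases n with
  | zero => simp
  | succ n =>
    have hprod : ∀ (n : ℕ) (A : ℕ → Set S), (∀ i, MeasurableSet (A i)) → ∀ z,
        jumpChain Q z {y | ∀ i < n, y i ∈ A i} =
          ∫⁻ y, ∏ i ∈ Finset.range n, (A i).indicator (1 : S → ℝ≥0∞) (y i) ∂jumpChain Q z := by
      intro n A hA z
      rw [← lintegral_indicator_one (measurableSet_forall_lt_mem n hA)]
      refine lintegral_congr fun y => ?_
      simp only [indicator_apply, Pi.one_apply, Finset.prod_ite_zero, Finset.prod_const_one,
        Finset.mem_range, mem_ofPred_eq]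
    have hset : seqCons x ⁻¹' {y | ∀ i < n + 1, y i ∈ A i} =
        {y | x ∈ A 0 ∧ ∀ i < n, y i ∈ A (i + 1)} := by
      ext y
      simp only [mem_preimage, mem_ofPred_eq]
      constructor
      · intro h
        exact ⟨h 0 (Nat.succ_pos n), fun i hi => h (i + 1) (Nat.succ_lt_succ hi)⟩
      · rintro ⟨h0, h1⟩ i hi
        cases i with
        | zero => exact h0
        | succ i => exact h1 i (Nat.lt_of_succ_lt_succ hi)
    rw [hprod _ A hA, hset, lintegral_prod_jumpChain Q n x fun i => measurable_one.indicator (hA i)]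
    by_cases hx : x ∈ A 0
    · simp only [indicator_of_mem hx, Pi.one_apply, one_mul, hx, true_and]
      exact lintegral_congr fun z => (hprod n _ (fun i => hA (i + 1)) z).symm
    · simp [hx]

/-- The laws of the paths, as a kernel. -/
def pathKernel : Kernel S ((ℕ → S) × (ℕ → ℝ)) where
  toFun := pathLaw Q
  measurable' := by
    let κ : Kernel S (ℕ → S) := ⟨jumpChain Q, measurable_jumpChain Q⟩
    have : IsMarkovKernel κ := ⟨fun x => inferInstanceAs (IsProbabilityMeasure (jumpChain Q x))⟩
    have h : pathLaw Q = κ ×ₖ Kernel.const S (Measure.infinitePi fun _ : ℕ => expMeasure 1) := by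
      ext1 x
      rw [Kernel.prod_apply]
      rfl
    rw [h]
    exact Kernel.measurable _

@[simp] theorem pathKernel_apply (x : S) : pathKernel Q x = pathLaw Q x := rfl

instance : IsMarkovKernel (pathKernel Q) :=
  ⟨fun x => inferInstanceAs (IsProbabilityMeasure (pathLaw Q x))⟩

/-- The path that starts with a sojourn of (normalized) length `s` at `x` and then follows `ω`. -/
def pathCons (x : S) (p : ℝ × ((ℕ → S) × (ℕ → ℝ))) : (ℕ → S) × (ℕ → ℝ) :=
  (seqCons x p.2.1, seqCons p.1 p.2.2)

theorem measurable_pathCons (x : S) : Measurable (pathCons x) := by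
  refine Measurable.prodMk ?_ ?_
  · exact measurable_seqCons.comp (measurable_const.prodMk (measurable_fst.comp measurable_snd))
  · exact measurable_seqCons.comp (measurable_fst.prodMk (measurable_snd.comp measurable_snd))

/-- The Markov property of the path at the first jump. -/
theorem pathLaw_eq_map (x : S) :
    pathLaw Q x =
      ((expMeasure 1).prod ((jumpKernel Q x).bind (pathKernel Q))).map (pathCons x) := by
  set E : Measure (ℕ → ℝ) := Measure.infinitePi fun _ : ℕ => expMeasure 1 with hE
  refine Measure.ext_of_lintegral _ fun F hF => ?_
  have hF' : Measurable fun p : ℝ × ((ℕ → S) × (ℕ → ℝ)) => F (pathCons x p) :=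
    hF.comp (measurable_pathCons x)
  have hL : ∀ y : ℕ → S, ∫⁻ e, F (y, e) ∂E =
      ∫⁻ e, ∫⁻ s, F (y, seqCons s e) ∂expMeasure 1 ∂E := by
    intro y
    have hy : Measurable fun e : ℕ → ℝ => F (y, e) := hF.comp measurable_prodMk_left
    have hy' : Measurable fun p : ℝ × (ℕ → ℝ) => F (y, seqCons p.1 p.2) :=
      hy.comp measurable_seqCons
    conv_lhs => rw [hE, infinitePi_eq_map_seqCons (expMeasure 1), lintegral_map hy
      measurable_seqCons, lintegral_prod_symm' _ hy']
  rw [lintegral_map hF (measurable_pathCons x), lintegral_prod_symm' _ hF',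
    Measure.lintegral_bind (Kernel.measurable _).aemeasurable
      hF'.lintegral_prod_left'.aemeasurable]
  have hG : Measurable fun y : ℕ → S => ∫⁻ e, F (y, e) ∂E := hF.lintegral_prod_right'
  calc ∫⁻ ω, F ω ∂pathLaw Q x = ∫⁻ y, ∫⁻ e, F (y, e) ∂E ∂jumpChain Q x :=
        lintegral_prod _ hF.aemeasurable
    _ = ∫⁻ z, ∫⁻ y, ∫⁻ e, F (seqCons x y, e) ∂E ∂jumpChain Q z ∂jumpKernel Q x := by
        have hc : Measurable (seqCons x) := measurable_seqCons.comp measurable_prodMk_left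
        have hGc : Measurable fun y : ℕ → S => ∫⁻ e, F (seqCons x y, e) ∂E := hG.comp hc
        rw [jumpChain_eq_map_bind Q x, lintegral_map hG hc,
          Measure.lintegral_bind (measurable_jumpChain Q).aemeasurable hGc.aemeasurable]
    _ = _ := by
        refine lintegral_congr fun z => ?_
        rw [pathKernel_apply, pathLaw, lintegral_prod _ hF'.lintegral_prod_left'.aemeasurable]
        exact lintegral_congr fun y => hL _

end PathLaw

/-! ### Jump times, lifetime and the state at a fixed time -/

section Trajectory

variable {S : Type*} [MeasurableSpace S] (Q : Kernel S S)

theorem measurable_jumpTime (n : ℕ) :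
    Measurable fun ω : (ℕ → S) × (ℕ → ℝ) => jumpTime Q ω n := by
  unfold jumpTime
  refine Finset.measurable_sum _ fun i _ => Measurable.div ?_ ?_
  · exact ENNReal.measurable_ofReal.comp ((measurable_pi_apply i).comp measurable_snd)
  · exact (Q.measurable_coe MeasurableSet.univ).comp ((measurable_pi_apply i).comp measurable_fst)

theorem jumpTime_mono (ω : (ℕ → S) × (ℕ → ℝ)) : Monotone (jumpTime Q ω) := by
  intro m n h
  exact Finset.sum_le_sum_of_subset (Finset.range_mono h)

theorem jumpTime_pathCons (x : S) (s : ℝ) (ω : (ℕ → S) × (ℕ → ℝ)) (n : ℕ) :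
    jumpTime Q (pathCons x (s, ω)) (n + 1) = ENNReal.ofReal s / Q x univ + jumpTime Q ω n := by
  simp only [jumpTime, pathCons]
  rw [Finset.sum_range_succ', add_comm]
  rfl

theorem measurable_process :
    Measurable fun p : ℝ × ((ℕ → S) × (ℕ → ℝ)) => process Q p.1 p.2 := by
  have hmem : ∀ n : ℕ, MeasurableSet {p : ℝ × ((ℕ → S) × (ℕ → ℝ)) |
      ENNReal.ofReal p.1 < jumpTime Q p.2 (n + 1)} := fun n =>
    measurableSet_lt (ENNReal.measurable_ofReal.comp measurable_fst)
      ((measurable_jumpTime Q (n + 1)).comp measurable_snd)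
  have hN : Measurable fun p : ℝ × ((ℕ → S) × (ℕ → ℝ)) =>
      sInf {n : ℕ | ENNReal.ofReal p.1 < jumpTime Q p.2 (n + 1)} := by
    refine measurable_of_Iic fun k => ?_
    -- The second set collects the paths that have exploded by the given time: there the index set
    -- is empty and its `sInf` is 0.
    have : (fun p : ℝ × ((ℕ → S) × (ℕ → ℝ)) =>
        sInf {n : ℕ | ENNReal.ofReal p.1 < jumpTime Q p.2 (n + 1)}) ⁻¹' Iic k =
        (⋃ n ∈ Iic k, {p | ENNReal.ofReal p.1 < jumpTime Q p.2 (n + 1)}) ∪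
          ⋂ n, {p | ENNReal.ofReal p.1 < jumpTime Q p.2 (n + 1)}ᶜ := by
      ext p
      simp only [mem_preimage, mem_Iic, mem_union, mem_iUnion, mem_ofPred_eq, mem_iInter,
        mem_compl_iff, exists_prop]
      constructor
      · intro h
        by_cases hne : {n : ℕ | ENNReal.ofReal p.1 < jumpTime Q p.2 (n + 1)}.Nonempty
        · exact Or.inl ⟨_, h, Nat.sInf_mem hne⟩
        · right
          intro n hn
          exact hne ⟨n, hn⟩
      · rintro (⟨n, hn, hp⟩ | h)
        · exact (Nat.sInf_le hp).trans hn
        · have : {n : ℕ | ENNReal.ofReal p.1 < jumpTime Q p.2 (n + 1)} = ∅ :=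
            eq_empty_of_forall_notMem h
          rw [this]
          simp
    rw [this]
    exact (MeasurableSet.biUnion (to_countable _) fun n _ => hmem n).union
      (MeasurableSet.iInter fun n => (hmem n).compl)
  have heval : Measurable fun r : (ℕ → S) × ℕ => r.1 r.2 :=
    measurable_from_prod_countable_left fun n => measurable_pi_apply n
  exact heval.comp ((measurable_fst.comp measurable_snd).prodMk hN)

/-- The time until which the path is defined by its jumps. -/
def lifetime (ω : (ℕ → S) × (ℕ → ℝ)) : ℝ≥0∞ := ⨆ n, jumpTime Q ω n

theorem measurable_lifetime : Measurable (lifetime Q) :=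
  Measurable.iSup fun n => measurable_jumpTime Q n

theorem lifetime_pathCons (x : S) (s : ℝ) (ω : (ℕ → S) × (ℕ → ℝ)) :
    lifetime Q (pathCons x (s, ω)) = ENNReal.ofReal s / Q x univ + lifetime Q ω := by
  unfold lifetime
  rw [ENNReal.add_iSup, ← (jumpTime_mono Q (pathCons x (s, ω))).iSup_nat_add 1]
  exact iSup_congr fun n => jumpTime_pathCons Q x s ω n

theorem process_pathCons_of_lt (x : S) {s t : ℝ} (ω : (ℕ → S) × (ℕ → ℝ))
    (h : ENNReal.ofReal t < ENNReal.ofReal s / Q x univ) :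
    process Q t (pathCons x (s, ω)) = x := by
  have h0 : 0 ∈ {n : ℕ | ENNReal.ofReal t < jumpTime Q (pathCons x (s, ω)) (n + 1)} := by
    simp only [mem_ofPred_eq, jumpTime_pathCons]
    exact h.trans_le le_self_add
  have : sInf {n : ℕ | ENNReal.ofReal t < jumpTime Q (pathCons x (s, ω)) (n + 1)} = 0 :=
    Nat.le_zero.1 (Nat.sInf_le h0)
  unfold process
  rw [this]
  rfl

/-- After the first sojourn all jump indices shift by one. An infinite lifetime is required because
after an explosion `process` falls back to the initial state of the path, which is not the same for
the shifted path. -/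
theorem process_pathCons_of_le (x : S) {s t u : ℝ} (ω : (ℕ → S) × (ℕ → ℝ)) (hu : 0 ≤ u)
    (hut : u ≤ t) (hs : ENNReal.ofReal s / Q x univ = ENNReal.ofReal u)
    (hω : lifetime Q ω = ∞) :
    process Q t (pathCons x (s, ω)) = process Q (t - u) ω := by
  have hsplit : ENNReal.ofReal t = ENNReal.ofReal u + ENNReal.ofReal (t - u) := by
    rw [← ENNReal.ofReal_add hu (sub_nonneg.2 hut)]
    congr 1
    ring
  have hmem : ∀ n, ENNReal.ofReal t < jumpTime Q (pathCons x (s, ω)) (n + 1) ↔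
      ENNReal.ofReal (t - u) < jumpTime Q ω n := by
    intro n
    rw [jumpTime_pathCons, hs, hsplit, ENNReal.add_lt_add_iff_left ENNReal.ofReal_ne_top]
  have hne : {n : ℕ | ENNReal.ofReal (t - u) < jumpTime Q ω (n + 1)}.Nonempty := by
    have : ENNReal.ofReal (t - u) < lifetime Q ω := by rw [hω]; exact ENNReal.ofReal_lt_top
    obtain ⟨n, hn⟩ := lt_iSup_iff.1 this
    exact ⟨n, hn.trans_le (jumpTime_mono Q ω n.le_succ)⟩
  have hinf : sInf {n : ℕ | ENNReal.ofReal t < jumpTime Q (pathCons x (s, ω)) (n + 1)} =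
      sInf {n : ℕ | ENNReal.ofReal (t - u) < jumpTime Q ω (n + 1)} + 1 := by
    have hset : {n : ℕ | ENNReal.ofReal t < jumpTime Q (pathCons x (s, ω)) (n + 1)} =
        {n : ℕ | ENNReal.ofReal (t - u) < jumpTime Q ω n} := by
      ext n
      exact hmem n
    have hne' : {n : ℕ | ENNReal.ofReal (t - u) < jumpTime Q ω n}.Nonempty :=
      ⟨_, hne.some_mem⟩
    -- The zeroth jump time is 0 and never exceeds a nonnegative time, so the infimum is positive
    -- and can be lowered by one.
    have hpos : 1 ≤ sInf {n : ℕ | ENNReal.ofReal (t - u) < jumpTime Q ω n} := by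
      by_contra h0
      have h1 : sInf {n : ℕ | ENNReal.ofReal (t - u) < jumpTime Q ω n} = 0 := by omega
      have h2 := Nat.sInf_mem hne'
      rw [h1] at h2
      simp [jumpTime] at h2
    rw [hset, Nat.sInf_add hpos]
  unfold process
  rw [hinf]
  rfl

/-- The expectation `E f(Z_x(t))` for the pure jump process `Z_x` with rates `Q` started at `x`. -/
def semigroup (t : ℝ) (f : S → ℝ) (x : S) : ℝ := ∫ ω, f (process Q t ω) ∂pathLaw Q x

end Trajectory

/-! ### Integration over the first sojourn -/

section FirstJump

theorem integral_expMeasure_one (g : ℝ → ℝ) :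
    ∫ s, g s ∂expMeasure 1 = ∫ s in Ioi (0 : ℝ), Real.exp (-s) * g s := by
  have hm : Measurable (exponentialPDF 1) :=
    ENNReal.measurable_ofReal.comp (measurable_exponentialPDFReal 1)
  have h : expMeasure 1 = volume.withDensity (exponentialPDF 1) := rfl
  rw [h, integral_withDensity_eq_integral_toReal_smul hm
    (ae_of_all _ fun _ => ENNReal.ofReal_lt_top), ← integral_Ici_eq_integral_Ioi,
    ← integral_indicator measurableSet_Ici]
  refine integral_congr_ae (ae_of_all _ fun s => ?_)
  simp only [exponentialPDF_eq, smul_eq_mul, one_mul, indicator_apply, mem_Ici]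
  split_ifs with hs
  · rw [ENNReal.toReal_ofReal (Real.exp_pos _).le]
  · simp

theorem ae_expMeasure_nonneg : ∀ᵐ s ∂expMeasure 1, 0 ≤ s := by
  have hm : Measurable (exponentialPDF 1) :=
    ENNReal.measurable_ofReal.comp (measurable_exponentialPDFReal 1)
  have h : expMeasure 1 = volume.withDensity (exponentialPDF 1) := rfl
  rw [h, ae_withDensity_iff hm]
  refine ae_of_all _ fun s hs => ?_
  by_contra hneg
  exact hs (exponentialPDF_of_neg (not_le.1 hneg))

variable {S : Type*} [MeasurableSpace S] (Q : Kernel S S)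

theorem integrable_of_bounded {X : Type*} [MeasurableSpace X] (P : Measure X) [IsFiniteMeasure P]
    {F : X → ℝ} (hF : Measurable F) {C : ℝ} (hC : ∀ x, |F x| ≤ C) : Integrable F P :=
  Integrable.of_bound hF.aestronglyMeasurable C (ae_of_all _ hC)

theorem abs_integral_le_of_bounded {X : Type*} [MeasurableSpace X] (P : Measure X)
    [IsProbabilityMeasure P] {F : X → ℝ} {C : ℝ} (hC : ∀ x, |F x| ≤ C) : |∫ x, F x ∂P| ≤ C := by
  simpa using norm_integral_le_of_norm_le_const (μ := P) (f := F) (C := C) (ae_of_all _ hC)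

theorem integral_bind_pathKernel (x : S) {F : (ℕ → S) × (ℕ → ℝ) → ℝ} (hF : Measurable F) {C : ℝ}
    (hC : ∀ ω, |F ω| ≤ C) :
    ∫ ω, F ω ∂(jumpKernel Q x).bind (pathKernel Q) =
      ∫ z, ∫ ω, F ω ∂pathLaw Q z ∂jumpKernel Q x := by
  rw [← Kernel.comp_apply]
  exact Kernel.integral_comp (integrable_of_bounded _ hF hC)

instance (x : S) : IsProbabilityMeasure ((jumpKernel Q x).bind (pathKernel Q)) := by
  rw [← Kernel.comp_apply]
  infer_instance

theorem integral_pathLaw (x : S) {F : (ℕ → S) × (ℕ → ℝ) → ℝ} (hF : Measurable F) {C : ℝ}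
    (hC : ∀ ω, |F ω| ≤ C) :
    ∫ ω, F ω ∂pathLaw Q x =
      ∫ s, ∫ ω, F (pathCons x (s, ω)) ∂(jumpKernel Q x).bind (pathKernel Q) ∂expMeasure 1 := by
  rw [pathLaw_eq_map Q x, integral_map (measurable_pathCons x).aemeasurable
    hF.aestronglyMeasurable, integral_prod]
  exact integrable_of_bounded _ (hF.comp (measurable_pathCons x)) fun _ => hC _

end FirstJump

/-! ### Birth-death dynamics and non-explosion -/

section BirthDeath

/-- The total jump rate of the birth-death process in state `n`. -/
def totalRate (a b β : ℝ) (n : ℕ) : ℝ := (a + b * n) + (n + β * n * (n - 1))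

/-- Rates `Q` such that, with respect to the size `sz` of the states, the process is the birth-death
process with birth rates `a + b n` and death rates `n + β n (n - 1)`. -/
structure IsBirthDeath {S : Type*} [MeasurableSpace S] (Q : Kernel S S) (sz : S → ℕ)
    (a b β : ℝ) : Prop where
  pos_a : 0 < a
  nonneg_b : 0 ≤ b
  b_lt_one : b < 1
  nonneg_β : 0 ≤ β
  measurable_size : Measurable sz
  map_size : ∀ x, (Q x).map sz = birthDeathRates a b β (sz x)
  eq_of_size_eq_zero : ∀ x y, sz x = 0 → sz y = 0 → x = y

theorem natCast_mul_sub_one_nonneg (n : ℕ) : (0 : ℝ) ≤ n * (n - 1) := by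
  cases n with
  | zero => simp
  | succ n =>
    push_cast
    rw [add_sub_cancel_right]
    positivity

variable {S : Type*} [MeasurableSpace S] {Q : Kernel S S} {sz : S → ℕ} {a b β : ℝ}

namespace IsBirthDeath

variable (h : IsBirthDeath Q sz a b β)
include h

theorem birthRate_pos (n : ℕ) : 0 < a + b * n := by
  have := h.pos_a
  have := h.nonneg_b
  positivity

theorem le_deathRate (n : ℕ) : (n : ℝ) ≤ n + β * n * (n - 1) := by
  have := mul_nonneg h.nonneg_β (natCast_mul_sub_one_nonneg n)
  linarith

theorem deathRate_nonneg (n : ℕ) : (0 : ℝ) ≤ n + β * n * (n - 1) :=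
  n.cast_nonneg.trans (h.le_deathRate n)

theorem totalRate_pos (n : ℕ) : 0 < totalRate a b β n :=
  add_pos_of_pos_of_nonneg (h.birthRate_pos n) (h.deathRate_nonneg n)

theorem rate_univ (x : S) : Q x univ = ENNReal.ofReal (totalRate a b β (sz x)) := by
  have h1 : Q x univ = (Q x).map sz univ := by
    rw [Measure.map_apply h.measurable_size MeasurableSet.univ, preimage_univ]
  rw [h1, h.map_size, totalRate, ENNReal.ofReal_add (h.birthRate_pos _).le (h.deathRate_nonneg _)]
  simp [birthDeathRates]

theorem rate_univ_ne_zero (x : S) : Q x univ ≠ 0 := by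
  rw [h.rate_univ]
  exact (ENNReal.ofReal_pos.2 (h.totalRate_pos _)).ne'

theorem rate_univ_ne_top (x : S) : Q x univ ≠ ∞ := by
  rw [h.rate_univ]
  exact ENNReal.ofReal_ne_top

theorem ofReal_div_rate (x : S) (s : ℝ) :
    ENNReal.ofReal s / Q x univ = ENNReal.ofReal (s / totalRate a b β (sz x)) := by
  rw [h.rate_univ, ENNReal.ofReal_div_of_pos (h.totalRate_pos _)]

theorem rate_smul_jumpKernel (x : S) : Q x = Q x univ • jumpKernel Q x := by
  have h1 : jumpKernel Q x = (Q x univ)⁻¹ • Q x :=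
    if_neg (not_or.2 ⟨h.rate_univ_ne_zero x, h.rate_univ_ne_top x⟩)
  rw [h1, smul_smul, ENNReal.mul_inv_cancel (h.rate_univ_ne_zero x) (h.rate_univ_ne_top x),
    one_smul]

theorem integral_rate (x : S) (g : S → ℝ) :
    ∫ y, g y ∂Q x = totalRate a b β (sz x) * ∫ y, g y ∂jumpKernel Q x := by
  conv_lhs => rw [h.rate_smul_jumpKernel x]
  rw [integral_smul_measure, h.rate_univ, ENNReal.toReal_ofReal (h.totalRate_pos _).le, smul_eq_mul]

/-- No growth condition on `w` is needed: after one jump the size takes at most two values. -/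
theorem integrable_size (x : S) (w : ℕ → ℝ) : Integrable (fun y => w (sz y)) (jumpKernel Q x) := by
  have h1 : Integrable (fun y => w (sz y)) (Q x) := by
    have h2 : Integrable w ((Q x).map sz) := by
      rw [h.map_size]
      refine Integrable.add_measure ?_ ?_
      · exact (integrable_dirac (by simp)).smul_measure ENNReal.ofReal_ne_top
      · exact (integrable_dirac (by simp)).smul_measure ENNReal.ofReal_ne_top
    exact h2.comp_measurable h.measurable_size
  rw [h.rate_smul_jumpKernel x] at h1
  exact (integrable_smul_measure (h.rate_univ_ne_zero x) (h.rate_univ_ne_top x)).1 h1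

/-- This computes the generator on functions of the size. The truncated `sz x - 1` is harmless at
size 0, where the death rate vanishes. -/
theorem totalRate_mul_integral_size (x : S) (w : ℕ → ℝ) :
    totalRate a b β (sz x) * ∫ y, w (sz y) ∂jumpKernel Q x =
      (a + b * sz x) * w (sz x + 1) + (sz x + β * sz x * (sz x - 1)) * w (sz x - 1) := by
  rw [← h.integral_rate x]
  have h3 : ∫ y, w (sz y) ∂Q x = ∫ n, w n ∂(Q x).map sz :=
    (integral_map h.measurable_size.aemeasurable (by fun_prop)).symm
  have h4 : birthDeathRates a b β (sz x) =
    ENNReal.ofReal (a + b * sz x) • Measure.dirac (sz x + 1) +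
    ENNReal.ofReal (sz x + β * sz x * (sz x - 1)) • Measure.dirac (sz x - 1) := rfl
  rw [h3, h.map_size, h4, integral_add_measure
    ((integrable_dirac (by simp)).smul_measure ENNReal.ofReal_ne_top)
    ((integrable_dirac (by simp)).smul_measure ENNReal.ofReal_ne_top), integral_smul_measure,
    integral_smul_measure, integral_dirac, integral_dirac,
    ENNReal.toReal_ofReal (h.birthRate_pos _).le, ENNReal.toReal_ofReal (h.deathRate_nonneg _)]
  rfl

end IsBirthDeath

/-- A maximum principle: a function bounded above whose positive values stay below every upper bound
by a fixed amount is nonpositive. -/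
theorem nonpos_of_le_sub {X : Type*} {D : X → ℝ} {B δ : ℝ} (hδ : 0 < δ) (hB : ∀ x, D x ≤ B)
    (hD : ∀ M, (∀ y, D y ≤ M) → ∀ x, 0 < D x → D x ≤ M - δ) (x : X) : D x ≤ 0 := by
  by_contra! hx
  have : Nonempty X := ⟨x⟩
  have hbdd : BddAbove (range D) := ⟨B, by rintro _ ⟨y, rfl⟩; exact hB y⟩
  have hM : ∀ y, D y ≤ ⨆ z, D z := fun y => le_ciSup hbdd y
  have h1 : ⨆ z, D z ≤ max ((⨆ z, D z) - δ) 0 := ciSup_le fun y => by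
    rcases le_or_gt (D y) 0 with hy | hy
    · exact hy.trans (le_max_right _ _)
    · exact (hD _ hM y hy).trans (le_max_left _ _)
  rcases le_max_iff.1 h1 with h2 | h2
  · linarith
  · linarith [hM x]

theorem exists_forall_lt_le (w : ℕ → ℝ) (hw : ∀ n, 0 ≤ w n) (N : ℕ) :
    ∃ R, 0 ≤ R ∧ ∀ n < N, w n ≤ R :=
  ⟨∑ i ∈ Finset.range N, w i, Finset.sum_nonneg fun i _ => hw i, fun _ hn =>
    Finset.single_le_sum (f := w) (fun i _ => hw i) (Finset.mem_range.2 hn)⟩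

/-- The discount `exp (-c τ)` of the time `τ`. -/
def discount (c : ℝ) (τ : ℝ≥0∞) : ℝ := if τ = ∞ then 0 else Real.exp (-c * τ.toReal)

theorem measurable_discount (c : ℝ) : Measurable (discount c) :=
  Measurable.ite (measurableSet_singleton _) measurable_const
    (Real.measurable_exp.comp (measurable_const.mul ENNReal.measurable_toReal))

theorem discount_nonneg (c : ℝ) (τ : ℝ≥0∞) : 0 ≤ discount c τ := by
  unfold discount
  split_ifs
  · rfl
  · exact (Real.exp_pos _).le

theorem discount_le_one {c : ℝ} (hc : 0 ≤ c) (τ : ℝ≥0∞) : discount c τ ≤ 1 := by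
  unfold discount
  split_ifs
  · exact zero_le_one
  · rw [Real.exp_le_one_iff]
    nlinarith [mul_nonneg hc (ENNReal.toReal_nonneg (a := τ))]

theorem discount_add (c : ℝ) (σ τ : ℝ≥0∞) : discount c (σ + τ) = discount c σ * discount c τ := by
  unfold discount
  by_cases hσ : σ = ∞
  · simp [hσ]
  by_cases hτ : τ = ∞
  · simp [hτ]
  rw [if_neg hσ, if_neg hτ, if_neg (ENNReal.add_ne_top.2 ⟨hσ, hτ⟩), ENNReal.toReal_add hσ hτ,
    ← Real.exp_add]
  ring_nf

theorem integral_discount_expMeasure {c r : ℝ} (hc : 0 ≤ c) (hr : 0 < r) :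
    ∫ s, discount c (ENNReal.ofReal (s / r)) ∂expMeasure 1 = r / (r + c) := by
  have h1 : ∀ s ∈ Ioi (0 : ℝ), Real.exp (-s) * discount c (ENNReal.ofReal (s / r)) =
      Real.exp (-(1 + c / r) * s) := by
    intro s hs
    rw [discount, if_neg ENNReal.ofReal_ne_top, ENNReal.toReal_ofReal (div_nonneg hs.out.le hr.le),
      ← Real.exp_add]
    congr 1
    field_simp
    ring
  have h2 : -(1 + c / r) < 0 := by
    have : 0 ≤ c / r := by positivity
    linarith
  rw [integral_expMeasure_one, setIntegral_congr_fun measurableSet_Ioi h1, integral_exp_mul_Ioi h2]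
  simp only [mul_zero, Real.exp_zero]
  field_simp

namespace IsBirthDeath

variable (h : IsBirthDeath Q sz a b β)
include h

/-- The lifetime is the first sojourn plus an independent contribution from the state after the
jump. The discount is multiplicative, and an exponential sojourn of rate r contributes r / (r + c).
-/
theorem integral_discount_lifetime {c : ℝ} (hc : 0 ≤ c) (x : S) :
    ∫ ω, discount c (lifetime Q ω) ∂pathLaw Q x =
      totalRate a b β (sz x) / (totalRate a b β (sz x) + c) *
        ∫ z, ∫ ω, discount c (lifetime Q ω) ∂pathLaw Q z ∂jumpKernel Q x := by
  have hm : Measurable fun ω => discount c (lifetime Q ω) :=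
    (measurable_discount c).comp (measurable_lifetime Q)
  have hb : ∀ ω, |discount c (lifetime Q ω)| ≤ 1 := fun ω => by
    rw [abs_of_nonneg (discount_nonneg _ _)]
    exact discount_le_one hc _
  rw [integral_pathLaw Q x hm hb, ← integral_bind_pathKernel Q x hm hb,
    ← integral_discount_expMeasure hc (h.totalRate_pos (sz x)), ← integral_mul_const]
  refine integral_congr_ae (ae_of_all _ fun s => ?_)
  simp only [lifetime_pathCons, discount_add, h.ofReal_div_rate, integral_const_mul]

/-- The process does not explode. -/
theorem ae_lifetime_eq_top (x : S) : ∀ᵐ ω ∂pathLaw Q x, lifetime Q ω = ∞ := by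
  have ha := h.pos_a
  -- The generator maps 1 + n to at most `a`; discounting at rate `a + 1` therefore gives this
  -- comparison function a drift of at most -1.
  set c : ℝ := a + 1 with hcdef
  have hc : 0 ≤ c := by positivity
  have hm : Measurable fun ω => discount c (lifetime Q ω) :=
    (measurable_discount c).comp (measurable_lifetime Q)
  have hb : ∀ ω, |discount c (lifetime Q ω)| ≤ 1 := fun ω => by
    rw [abs_of_nonneg (discount_nonneg _ _)]
    exact discount_le_one hc _
  set φ : S → ℝ := fun x => ∫ ω, discount c (lifetime Q ω) ∂pathLaw Q x with hφ
  have hφm : Measurable φ := by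
    have : StronglyMeasurable fun x => ∫ ω, discount c (lifetime Q ω) ∂pathKernel Q x :=
      hm.stronglyMeasurable.integral_kernel
    exact this.measurable
  have hφb : ∀ x, |φ x| ≤ 1 := fun x => abs_integral_le_of_bounded _ hb
  -- The difference can be positive only at sizes below 1/ε because `φ` is at most 1. There the
  -- rates are bounded by `R`, so the drift yields the uniform decrement needed by
  -- `nonpos_of_le_sub`.
  have hle : ∀ ε : ℝ, 0 < ε → ∀ x, φ x - ε * (1 + sz x) ≤ 0 := by
    intro ε hε
    obtain ⟨N, hN⟩ := exists_nat_gt (1 / ε)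
    obtain ⟨R, hR0, hR⟩ := exists_forall_lt_le (totalRate a b β) (fun n => (h.totalRate_pos n).le) N
    have hδ : 0 < ε / (R + c) := by positivity
    refine nonpos_of_le_sub hδ (B := 1) (fun x => ?_) fun M hM x hx => ?_
    · have : 0 ≤ ε * (1 + sz x) := by positivity
      linarith [(abs_le.1 (hφb x)).2]
    · set r := totalRate a b β (sz x) with hr
      have hrpos : 0 < r := h.totalRate_pos _
      have hsz : sz x < N := by
        have h1 : ε * (1 + sz x) < 1 := by linarith [(abs_le.1 (hφb x)).2]
        have h2 : (sz x : ℝ) < N := by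
          have : (1 + (sz x : ℝ)) < 1 / ε := by rw [lt_div_iff₀ hε]; linarith
          linarith
        exact_mod_cast h2
      have hrR : r ≤ R := hR _ hsz
      have hstep : φ x = r / (r + c) * ∫ z, φ z ∂jumpKernel Q x := h.integral_discount_lifetime hc x
      have hint : ∫ z, φ z ∂jumpKernel Q x ≤
          M + ε * ∫ z, (1 + (sz z : ℝ)) ∂jumpKernel Q x := by
        have hI := h.integrable_size x fun n => 1 + (n : ℝ)
        calc ∫ z, φ z ∂jumpKernel Q x ≤ ∫ z, (M + ε * (1 + (sz z : ℝ))) ∂jumpKernel Q x :=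
              integral_mono (integrable_of_bounded _ hφm hφb)
                ((integrable_const M).add (hI.const_mul ε)) fun z => by
                  have := hM z
                  dsimp only
                  linarith
          _ = _ := by
              rw [integral_add (integrable_const M) (hI.const_mul ε), integral_const_mul]
              simp
      have hw := h.totalRate_mul_integral_size x fun n => 1 + (n : ℝ)
      have hdown : (sz x + β * sz x * (sz x - 1)) * (1 + ((sz x - 1 : ℕ) : ℝ)) =
          (sz x + β * sz x * (sz x - 1)) * sz x := by
        rcases Nat.eq_zero_or_pos (sz x) with h0 | h0
        · simp [h0]
        · rw [Nat.cast_sub h0]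
          push_cast
          ring
      rw [hdown, ← hr] at hw
      push_cast at hw
      have hmul : (r + c) * φ x ≤ r * M + ε * (r * ∫ z, (1 + (sz z : ℝ)) ∂jumpKernel Q x) := by
        rw [hstep]
        have : (r + c) * (r / (r + c) * ∫ z, φ z ∂jumpKernel Q x) =
            r * ∫ z, φ z ∂jumpKernel Q x := by field_simp
        rw [this]
        nlinarith
      rw [hw] at hmul
      have hdr := h.le_deathRate (sz x)
      have hr' : r = (a + b * sz x) + (sz x + β * sz x * (sz x - 1)) := rfl
      have hb1 := h.b_lt_one
      have hn0 : (0 : ℝ) ≤ sz x := Nat.cast_nonneg _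
      have hdrift : (a + b * sz x) * (1 + (sz x + 1)) +
          (sz x + β * sz x * (sz x - 1)) * sz x - (r + c) * (1 + sz x) ≤ -1 := by
        rw [hr', hcdef]
        nlinarith
      have hfin : (r + c) * (φ x - ε * (1 + sz x)) ≤ r * M - ε := by
        nlinarith
      have hM0 : 0 < M := hx.trans_le (hM x)
      have hfin2 : φ x - ε * (1 + sz x) ≤ M - ε / (r + c) := by
        have h5 : M - ε / (r + c) = ((r + c) * M - ε) / (r + c) := by field_simp
        rw [h5, le_div_iff₀ (by positivity)]
        nlinarith
      refine hfin2.trans ?_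
      have : ε / (R + c) ≤ ε / (r + c) := by gcongr
      linarith
  have hφ0 : φ x = 0 := by
    refine le_antisymm ?_ (integral_nonneg fun ω => discount_nonneg _ _)
    refine le_of_forall_pos_le_add fun ε hε => ?_
    have := hle (ε / (1 + sz x)) (by positivity) x
    rw [div_mul_cancel₀ _ (by positivity)] at this
    linarith
  -- The discount is strictly positive at every finite lifetime, so a vanishing mean forces an
  -- infinite lifetime almost surely.
  have h0 := (integral_eq_zero_iff_of_nonneg (fun ω => discount_nonneg c (lifetime Q ω))
    (integrable_of_bounded _ hm hb)).1 hφ0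
  filter_upwards [h0] with ω hω
  by_contra hne
  simp only [discount, if_neg hne, Pi.zero_apply] at hω
  exact (Real.exp_pos _).ne' hω

end IsBirthDeath

end BirthDeath

/-! ### The backward equation -/

section Semigroup

variable {S : Type*} [MeasurableSpace S] (Q : Kernel S S) {f : S → ℝ}

theorem measurable_semigroup (hf : Measurable f) :
    Measurable fun p : ℝ × S => semigroup Q p.1 f p.2 := by
  have hF : Measurable fun p : (ℝ × S) × ((ℕ → S) × (ℕ → ℝ)) => f (process Q p.1.1 p.2) :=
    hf.comp ((measurable_process Q).comp
      ((measurable_fst.comp measurable_fst).prodMk measurable_snd))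
  have := hF.stronglyMeasurable.integral_kernel_prod_right'
    (κ := (pathKernel Q).comap (Prod.snd : ℝ × S → S) measurable_snd)
  exact this.measurable

theorem measurable_process_apply (t : ℝ) : Measurable (process Q t) :=
  (measurable_process Q).comp measurable_prodMk_left

theorem measurable_comp_process (hf : Measurable f) (t : ℝ) :
    Measurable fun ω => f (process Q t ω) :=
  hf.comp (measurable_process_apply Q t)

theorem measurable_semigroup_apply (hf : Measurable f) (t : ℝ) : Measurable (semigroup Q t f) :=
  Measurable.comp (g := fun p : ℝ × S => semigroup Q p.1 f p.2) (f := fun x => (t, x))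
    (measurable_semigroup Q hf) measurable_prodMk_left

theorem abs_semigroup_le {C : ℝ} (hC : ∀ x, |f x| ≤ C) (t : ℝ) (x : S) :
    |semigroup Q t f x| ≤ C :=
  abs_integral_le_of_bounded _ fun _ => hC _

/-- The mean of `semigroup Q t f` after a jump from `x`. -/
def jumpMean (f : S → ℝ) (x : S) (t : ℝ) : ℝ := ∫ z, semigroup Q t f z ∂jumpKernel Q x

theorem measurable_jumpMean (hf : Measurable f) :
    Measurable fun p : S × ℝ => jumpMean Q f p.1 p.2 := by
  have hF : Measurable fun p : (S × ℝ) × S => semigroup Q p.1.2 f p.2 :=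
    Measurable.comp (g := fun p : ℝ × S => semigroup Q p.1 f p.2)
      (f := fun p : (S × ℝ) × S => (p.1.2, p.2)) (measurable_semigroup Q hf)
      ((measurable_snd.comp measurable_fst).prodMk measurable_snd)
  have := hF.stronglyMeasurable.integral_kernel_prod_right'
    (κ := (jumpKernel Q).comap (Prod.fst : S × ℝ → S) measurable_fst)
  exact this.measurable

theorem measurable_jumpMean_apply (hf : Measurable f) (x : S) : Measurable (jumpMean Q f x) :=
  Measurable.comp (g := fun p : S × ℝ => jumpMean Q f p.1 p.2) (f := fun t => (x, t))
    (measurable_jumpMean Q hf) measurable_prodMk_left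

theorem abs_jumpMean_le {C : ℝ} (hC : ∀ x, |f x| ≤ C) (x : S) (t : ℝ) :
    |jumpMean Q f x t| ≤ C :=
  abs_integral_le_of_bounded _ fun z => abs_semigroup_le Q hC t z

theorem intervalIntegrable_of_bounded {k : ℝ → ℝ} (hk : Measurable k) {C : ℝ}
    (hC : ∀ t, |k t| ≤ C) (u v : ℝ) : IntervalIntegrable k volume u v := by
  refine ⟨?_, ?_⟩ <;> exact integrable_of_bounded _ hk hC

variable {Q} {sz : S → ℕ} {a b β C : ℝ}

theorem intervalIntegrable_exp_mul_jumpMean (hf : Measurable f) (hC : ∀ x, |f x| ≤ C) (x : S)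
    (r u v : ℝ) :
    IntervalIntegrable (fun v => r * Real.exp (r * v) * jumpMean Q f x v) volume u v :=
  (intervalIntegrable_of_bounded (measurable_jumpMean_apply Q hf x)
    (abs_jumpMean_le Q hC x) u v).continuousOn_mul (by fun_prop)

namespace IsBirthDeath

variable (h : IsBirthDeath Q sz a b β) (hf : Measurable f) (hC : ∀ x, |f x| ≤ C)
include h hf hC

theorem integral_process_pathCons {t : ℝ} (ht : 0 ≤ t) (x : S) {s : ℝ} (hs : 0 ≤ s) :
    ∫ ω, f (process Q t (pathCons x (s, ω))) ∂(jumpKernel Q x).bind (pathKernel Q) =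
      if t < s / totalRate a b β (sz x) then f x
      else jumpMean Q f x (t - s / totalRate a b β (sz x)) := by
  have hr := h.totalRate_pos (sz x)
  split_ifs with hts
  · have h1 : ∀ ω, process Q t (pathCons x (s, ω)) = x := fun ω =>
      process_pathCons_of_lt Q x ω (by
        rw [h.ofReal_div_rate]
        exact (ENNReal.ofReal_lt_ofReal_iff (ht.trans_lt hts)).2 hts)
    simp [h1]
  · set u := s / totalRate a b β (sz x) with hu
    have hu0 : 0 ≤ u := div_nonneg hs hr.le
    -- Non-explosion enters here: it permits restarting the path at its first jump.
    have hae : ∀ᵐ ω ∂(jumpKernel Q x).bind (pathKernel Q), lifetime Q ω = ∞ := by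
      refine Measure.ae_comp_of_ae_ae ?_ (ae_of_all _ fun z => h.ae_lifetime_eq_top z)
      exact measurable_lifetime Q (measurableSet_singleton _)
    have h1 : ∫ ω, f (process Q t (pathCons x (s, ω))) ∂(jumpKernel Q x).bind (pathKernel Q) =
        ∫ ω, f (process Q (t - u) ω) ∂(jumpKernel Q x).bind (pathKernel Q) := by
      refine integral_congr_ae ?_
      filter_upwards [hae] with ω hω
      rw [process_pathCons_of_le Q x ω hu0 (not_lt.1 hts) (h.ofReal_div_rate x s) hω]
    rw [h1, integral_bind_pathKernel Q x (measurable_comp_process Q hf _) fun _ => hC _]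
    rfl

/-- The backward equation in integrated form. -/
theorem semigroup_eq {t : ℝ} (ht : 0 ≤ t) (x : S) :
    semigroup Q t f x = Real.exp (-totalRate a b β (sz x) * t) * (f x +
      ∫ v in (0 : ℝ)..t, totalRate a b β (sz x) * Real.exp (totalRate a b β (sz x) * v) *
        jumpMean Q f x v) := by
  set r := totalRate a b β (sz x) with hrdef
  have hr : 0 < r := h.totalRate_pos (sz x)
  -- The conditional mean given that the first jump occurs at time `v`. It is integrated against the
  -- exponential density of rate `r`, split at `t`, and the part up to `t` is reflected by v ↦ t -
  -- v.
  let I : ℝ → ℝ := fun v => if t < v then f x else jumpMean Q f x (t - v)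
  have h1 : semigroup Q t f x = ∫ s in Ioi (0 : ℝ), Real.exp (-s) * I (s / r) := by
    rw [semigroup, integral_pathLaw Q x (measurable_comp_process Q hf t) fun _ => hC _,
      ← integral_expMeasure_one]
    refine integral_congr_ae ?_
    filter_upwards [ae_expMeasure_nonneg] with s hs
    exact h.integral_process_pathCons hf hC ht x hs
  have h2 : ∫ s in Ioi (0 : ℝ), Real.exp (-s) * I (s / r) =
      ∫ v in Ioi (0 : ℝ), r * (Real.exp (-(r * v)) * I v) := by
    have := integral_comp_mul_left_Ioi (fun s => Real.exp (-s) * I (s / r)) 0 hr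
    rw [mul_zero] at this
    have h3 : ∫ v in Ioi (0 : ℝ), r * (Real.exp (-(r * v)) * I v) =
        r * ∫ v in Ioi (0 : ℝ), Real.exp (-(r * v)) * I (r * v / r) := by
      rw [← integral_const_mul]
      refine setIntegral_congr_fun measurableSet_Ioi fun v _ => ?_
      simp only [mul_div_cancel_left₀ v hr.ne']
    rw [h3, this, smul_eq_mul, ← mul_assoc, mul_inv_cancel₀ hr.ne', one_mul]
  have hIm : Measurable I := Measurable.ite measurableSet_Ioi measurable_const
    ((measurable_jumpMean_apply Q hf x).comp (measurable_const.sub measurable_id))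
  have hIb : ∀ v, |I v| ≤ C := fun v => by
    dsimp only [I]
    split_ifs
    · exact hC x
    · exact abs_jumpMean_le Q hC x _
  have hint : IntegrableOn (fun v => r * (Real.exp (-(r * v)) * I v)) (Ioi 0) := by
    have hexp : IntegrableOn (fun v : ℝ => Real.exp (-(r * v))) (Ioi 0) := by
      simpa only [neg_mul] using exp_neg_integrableOn_Ioi 0 hr
    refine Integrable.const_mul (Integrable.mul_bdd (c := C) hexp hIm.aestronglyMeasurable ?_) r
    exact ae_of_all _ hIb
  have h4 : ∫ v in Ioi (0 : ℝ), r * (Real.exp (-(r * v)) * I v) =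
      (∫ v in Ioc 0 t, r * (Real.exp (-(r * v)) * I v)) +
        ∫ v in Ioi t, r * (Real.exp (-(r * v)) * I v) := by
    rw [← Ioc_union_Ioi_eq_Ioi ht]
    refine setIntegral_union Ioc_disjoint_Ioi_same measurableSet_Ioi ?_ ?_
    · exact hint.mono_set Ioc_subset_Ioi_self
    · exact hint.mono_set (Ioi_subset_Ioi ht)
  have h5 : ∫ v in Ioi t, r * (Real.exp (-(r * v)) * I v) = Real.exp (-r * t) * f x := by
    have : ∀ v ∈ Ioi t, r * (Real.exp (-(r * v)) * I v) = (r * f x) * Real.exp (-r * v) := by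
      intro v hv
      simp only [I, if_pos hv.out, neg_mul]
      ring
    rw [setIntegral_congr_fun measurableSet_Ioi this, integral_const_mul,
      integral_exp_mul_Ioi (neg_neg_of_pos hr)]
    field_simp
  have h6 : ∫ v in Ioc 0 t, r * (Real.exp (-(r * v)) * I v) = Real.exp (-r * t) *
      ∫ v in (0 : ℝ)..t, r * Real.exp (r * v) * jumpMean Q f x v := by
    have hsub := intervalIntegral.integral_comp_sub_left (a := 0) (b := t)
      (fun v => Real.exp (-r * t) * (r * Real.exp (r * v) * jumpMean Q f x v)) t
    rw [sub_self, sub_zero] at hsub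
    rw [← intervalIntegral.integral_const_mul, ← hsub, intervalIntegral.integral_of_le ht]
    refine setIntegral_congr_fun measurableSet_Ioc fun v hv => ?_
    simp only [I, if_neg (not_lt.2 hv.2)]
    have : Real.exp (-(r * v)) = Real.exp (-r * t) * Real.exp (r * (t - v)) := by
      rw [← Real.exp_add]
      ring_nf
    rw [this]
    ring
  rw [h1, h2, h4, h5, h6]
  ring

theorem semigroup_zero (x : S) : semigroup Q 0 f x = f x := by
  rw [h.semigroup_eq hf hC le_rfl]
  simp

theorem continuousOn_semigroup (x : S) : ContinuousOn (fun t => semigroup Q t f x) (Ici 0) := by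
  refine ContinuousOn.congr (Continuous.continuousOn ?_) fun t ht => h.semigroup_eq hf hC ht x
  have := intervalIntegral.continuous_primitive
    (intervalIntegrable_exp_mul_jumpMean (Q := Q) hf hC x (totalRate a b β (sz x))) 0
  fun_prop

/-- Continuity of the integrand is what upgrades the integrated backward equation to a pointwise
derivative. -/
theorem continuousOn_jumpMean (x : S) : ContinuousOn (jumpMean Q f x) (Ici 0) :=
  continuousOn_of_dominated (bound := fun _ => C)
    (fun t _ => (measurable_semigroup_apply Q hf t).aestronglyMeasurable)
    (fun t _ => ae_of_all _ fun z => abs_semigroup_le Q hC t z) (integrable_const C)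
    (ae_of_all _ fun z => h.continuousOn_semigroup hf hC z)

/-- The backward equation. -/
theorem hasDerivAt_semigroup (x : S) {t : ℝ} (ht : 0 < t) :
    HasDerivAt (fun t => semigroup Q t f x)
      (totalRate a b β (sz x) * (jumpMean Q f x t - semigroup Q t f x)) t := by
  set r := totalRate a b β (sz x) with hr
  have hk : HasDerivAt (fun u => ∫ v in (0 : ℝ)..u, r * Real.exp (r * v) * jumpMean Q f x v)
      (r * Real.exp (r * t) * jumpMean Q f x t) t := by
    refine intervalIntegral.integral_hasDerivAt_right
      (intervalIntegrable_exp_mul_jumpMean hf hC x r 0 t) ?_ ?_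
    · refine Measurable.stronglyMeasurable ?_ |>.stronglyMeasurableAtFilter
      exact (by fun_prop : Measurable fun v : ℝ => r * Real.exp (r * v)).mul
        (measurable_jumpMean_apply Q hf x)
    · exact ContinuousAt.mul (by fun_prop)
        ((h.continuousOn_jumpMean hf hC x).continuousAt (Ici_mem_nhds ht))
  have he : HasDerivAt (fun u : ℝ => Real.exp (-r * u)) (Real.exp (-r * t) * (-r * 1)) t :=
    ((hasDerivAt_id t).const_mul (-r)).exp
  have hp := he.mul (hk.const_add (f x))
  have heq : (fun u => semigroup Q u f x) =ᶠ[nhds t] fun u => Real.exp (-r * u) *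
      (f x + ∫ v in (0 : ℝ)..u, r * Real.exp (r * v) * jumpMean Q f x v) := by
    filter_upwards [Ioi_mem_nhds ht] with u hu
    exact h.semigroup_eq hf hC hu.out.le x
  refine (hp.congr_of_eventuallyEq heq).congr_deriv ?_
  rw [h.semigroup_eq hf hC ht.le x, ← hr]
  have : Real.exp (-r * t) * (r * Real.exp (r * t) * jumpMean Q f x t) = r * jumpMean Q f x t := by
    have h1 : Real.exp (-r * t) * Real.exp (r * t) = 1 := by
      rw [← Real.exp_add]
      simp
    linear_combination (r * jumpMean Q f x t) * h1
  rw [this]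
  ring

end IsBirthDeath

end Semigroup

/-! ### Tools for comparing two initial states -/

/-- Integrated Gronwall bound for `p' = R - c p`. -/
theorem mul_integral_abs_le {p R : ℝ → ℝ} {c T : ℝ} (hc : 0 ≤ c) (hT : 0 ≤ T)
    (hp : ContinuousOn p (Icc 0 T)) (hR : IntegrableOn R (Icc 0 T))
    (hderiv : ∀ t ∈ Ioo 0 T, HasDerivAt p (R t - c * p t) t) :
    c * ∫ t in Ioc 0 T, |p t| ≤ |p 0| + ∫ t in Ioc 0 T, |R t| := by
  have hpi : IntegrableOn (fun t => |p t|) (Icc 0 T) := hp.abs.integrableOn_Icc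
  have hRi : IntegrableOn (fun t => |R t|) (Icc 0 T) := hR.abs
  -- The absolute value is smoothed to √(p² + ε²), whose derivative is at most |R| - c|p| + cε;
  -- integrating costs only the stated multiple of ε.
  have key : ∀ ε : ℝ, 0 < ε →
      c * ∫ t in Ioc 0 T, |p t| ≤ |p 0| + (∫ t in Ioc 0 T, |R t|) + ε * (1 + c * T) := by
    intro ε hε
    have hpos : ∀ t, 0 < p t ^ 2 + ε ^ 2 := fun t => by positivity
    have hint : IntegrableOn (fun t => |R t| - c * |p t| + c * ε) (Icc 0 T) :=
      (hRi.sub (hpi.const_mul c)).add (integrableOn_const (by simp))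
    have hle := intervalIntegral.sub_le_integral_of_hasDeriv_right_of_le hT
      (g := fun t => √(p t ^ 2 + ε ^ 2))
      (g' := fun t => p t * (R t - c * p t) / √(p t ^ 2 + ε ^ 2))
      (φ := fun t => |R t| - c * |p t| + c * ε) ?_ ?_ hint ?_
    · rw [intervalIntegral.integral_of_le hT] at hle
      have hI : ∫ t in Ioc 0 T, (|R t| - c * |p t| + c * ε) =
          (∫ t in Ioc 0 T, |R t|) - c * (∫ t in Ioc 0 T, |p t|) + T * (c * ε) := by
        have h1 := hRi.mono_set Ioc_subset_Icc_self
        have h2 := (hpi.mono_set Ioc_subset_Icc_self).const_mul c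
        have h12 : IntegrableOn (fun t => |R t| - c * |p t|) (Ioc 0 T) := h1.sub h2
        rw [integral_add h12 (integrableOn_const (by simp)), integral_sub h1 h2,
          integral_const_mul]
        simp [hT]
      rw [hI] at hle
      have h3 : √(p 0 ^ 2 + ε ^ 2) ≤ |p 0| + ε := by
        rw [Real.sqrt_le_left (by positivity)]
        nlinarith [abs_nonneg (p 0), sq_abs (p 0)]
      have h4 := Real.sqrt_nonneg (p T ^ 2 + ε ^ 2)
      nlinarith
    · exact ((hp.pow 2).add continuousOn_const).sqrt
    · intro t ht
      have h1 := (((hderiv t ht).pow 2).add_const (ε ^ 2)).sqrt (hpos t).ne'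
      refine (h1.congr_deriv ?_).hasDerivWithinAt
      have hg := Real.sqrt_pos.2 (hpos t)
      simp only [Pi.pow_apply, Nat.cast_ofNat, Nat.add_one_sub_one, pow_one]
      field_simp
    · intro t _
      have hg := Real.sqrt_pos.2 (hpos t)
      have hg1 : |p t| ≤ √(p t ^ 2 + ε ^ 2) := Real.abs_le_sqrt (by nlinarith)
      have hg2 : √(p t ^ 2 + ε ^ 2) ≤ |p t| + ε := by
        rw [Real.sqrt_le_left (by positivity)]
        nlinarith [abs_nonneg (p t), sq_abs (p t)]
      rw [div_le_iff₀ hg]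
      have h1 : p t * R t ≤ |R t| * √(p t ^ 2 + ε ^ 2) := by
        calc p t * R t ≤ |p t * R t| := le_abs_self _
          _ = |R t| * |p t| := by rw [abs_mul, mul_comm]
          _ ≤ _ := by gcongr
      have h2 : (|p t| - ε) * √(p t ^ 2 + ε ^ 2) ≤ p t ^ 2 := by
        rcases le_total (|p t|) ε with hpe | hpe
        · nlinarith [sq_nonneg (p t)]
        · nlinarith [sq_abs (p t)]
      nlinarith [mul_le_mul_of_nonneg_left h2 hc]
  refine le_of_forall_pos_le_add fun ε hε => ?_
  have := key (ε / (1 + c * T)) (by positivity)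
  rwa [div_mul_cancel₀ _ (by positivity)] at this

/-- The increments of the Lyapunov function of the pair of independent processes. -/
def lyapunovIncrement (a b : ℝ) (n : ℕ) : ℝ := (1 + 2 * a + b) ^ (⌈(1 + 2 * a) / (1 - b)⌉₊ - n)

/-- The Lyapunov function of the pair of independent processes, as a function of the total size. -/
def lyapunov (a b : ℝ) (n : ℕ) : ℝ := ∑ i ∈ Finset.range n, lyapunovIncrement a b i

section Lyapunov

variable {a b : ℝ} (ha : 0 < a) (hb : 0 ≤ b)
include ha hb

theorem one_le_lyapunovIncrement (n : ℕ) : 1 ≤ lyapunovIncrement a b n :=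
  one_le_pow₀ (by linarith)

/-- At total size n + 1 the pair gains a point at rate 2a + b(n + 1) and loses one at rate at least
n + 1. For small n the geometric decay of the increments makes a loss outweigh a gain. From the
ceiling on, the truncated exponent is 0, all increments are 1, and `b < 1` suffices. -/
theorem lyapunovIncrement_drift (hb1 : b < 1) (n : ℕ) :
    1 + (2 * a + b * (n + 1)) * lyapunovIncrement a b (n + 1) ≤
      (n + 1) * lyapunovIncrement a b n := by
  have h1 := one_le_lyapunovIncrement ha hb (n + 1)
  have hn : (0 : ℝ) ≤ n := n.cast_nonneg
  unfold lyapunovIncrement at h1 ⊢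
  set N := ⌈(1 + 2 * a) / (1 - b)⌉₊ with hN
  rcases lt_or_ge n N with hlt | hge
  · have : N - n = (N - (n + 1)) + 1 := by omega
    rw [this, pow_succ]
    set d := (1 + 2 * a + b) ^ (N - (n + 1)) with hd
    have h2 : 1 + (2 * a + b * (n + 1)) ≤ (n + 1) * (1 + 2 * a + b) := by nlinarith
    nlinarith [mul_le_mul_of_nonneg_right h2 (zero_le_one.trans h1)]
  · rw [Nat.sub_eq_zero_of_le hge, Nat.sub_eq_zero_of_le (by omega)]
    have h2 : (1 + 2 * a) / (1 - b) ≤ n := (Nat.le_ceil _).trans (by exact_mod_cast hge)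
    rw [div_le_iff₀ (by linarith)] at h2
    simp only [pow_zero, mul_one]
    nlinarith

theorem le_lyapunov (n : ℕ) : (n : ℝ) ≤ lyapunov a b n := by
  have := Finset.card_nsmul_le_sum (Finset.range n) (lyapunovIncrement a b) 1 fun i _ =>
    one_le_lyapunovIncrement ha hb i
  simpa [lyapunov] using this

theorem lyapunov_le (n : ℕ) : lyapunov a b n ≤ lyapunovIncrement a b 0 * n := by
  have := Finset.sum_le_card_nsmul (Finset.range n) (lyapunovIncrement a b)
    (lyapunovIncrement a b 0) fun i _ => pow_le_pow_right₀ (by linarith) (by omega)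
  simpa [lyapunov, mul_comm] using this

end Lyapunov

/-! ### Integrated distance between two initial states -/

section Coupling

variable {S : Type*} [MeasurableSpace S] {Q : Kernel S S} {sz : S → ℕ} {a b β C : ℝ} {f : S → ℝ}

/-- The distance of the expectations for two initial states, integrated over `(0, T]`. -/
def totalGap (Q : Kernel S S) (f : S → ℝ) (T : ℝ) (x y : S) : ℝ :=
  ∫ t in Ioc 0 T, |semigroup Q t f x - semigroup Q t f y|

theorem measurable_gap (hf : Measurable f) :
    Measurable fun p : ℝ × S × S => |semigroup Q p.1 f p.2.1 - semigroup Q p.1 f p.2.2| := by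
  have h1 : Measurable fun p : ℝ × S × S => semigroup Q p.1 f p.2.1 :=
    Measurable.comp (g := fun p : ℝ × S => semigroup Q p.1 f p.2)
      (f := fun p : ℝ × S × S => (p.1, p.2.1)) (measurable_semigroup Q hf) (by fun_prop)
  have h2 : Measurable fun p : ℝ × S × S => semigroup Q p.1 f p.2.2 :=
    Measurable.comp (g := fun p : ℝ × S => semigroup Q p.1 f p.2)
      (f := fun p : ℝ × S × S => (p.1, p.2.2)) (measurable_semigroup Q hf) (by fun_prop)
  exact (h1.sub h2).abs

theorem gap_le (hC : ∀ x, |f x| ≤ C) (t : ℝ) (x y : S) :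
    |semigroup Q t f x - semigroup Q t f y| ≤ 2 * C := by
  have h1 := abs_semigroup_le Q hC t x
  have h2 := abs_semigroup_le Q hC t y
  calc _ ≤ |semigroup Q t f x| + |semigroup Q t f y| := abs_sub _ _
    _ ≤ 2 * C := by linarith

theorem measurable_totalGap (hf : Measurable f) (T : ℝ) :
    Measurable fun p : S × S => totalGap Q f T p.1 p.2 := by
  have := (measurable_gap (Q := Q) hf).stronglyMeasurable.integral_prod_left'
    (μ := volume.restrict (Ioc 0 T))
  exact this.measurable

theorem totalGap_nonneg (T : ℝ) (x y : S) : 0 ≤ totalGap Q f T x y :=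
  integral_nonneg fun _ => abs_nonneg _

theorem totalGap_le (hC : ∀ x, |f x| ≤ C) {T : ℝ} (hT : 0 ≤ T) (x y : S) :
    totalGap Q f T x y ≤ 2 * C * T := by
  have := norm_integral_le_of_norm_le_const (μ := volume.restrict (Ioc 0 T)) (C := 2 * C)
    (f := fun t => |semigroup Q t f x - semigroup Q t f y|)
    (ae_of_all _ fun t => by
      rw [Real.norm_eq_abs, abs_abs]
      exact gap_le hC t x y)
  simp only [Real.norm_eq_abs, measureReal_restrict_apply_univ, Real.volume_real_Ioc_of_le hT,
    sub_zero] at this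
  exact (le_abs_self _).trans this

theorem integral_integral_gap (hf : Measurable f) (hC : ∀ x, |f x| ≤ C) (T : ℝ) (P : Measure S)
    [IsProbabilityMeasure P] (y : S) :
    ∫ t in Ioc 0 T, ∫ z, |semigroup Q t f z - semigroup Q t f y| ∂P =
      ∫ z, totalGap Q f T z y ∂P := by
  refine integral_integral_swap (f := fun t z => |semigroup Q t f z - semigroup Q t f y|) ?_
  refine integrable_of_bounded (C := 2 * C) _ ?_ fun p => ?_
  · exact Measurable.comp
      (g := fun p : ℝ × S × S => |semigroup Q p.1 f p.2.1 - semigroup Q p.1 f p.2.2|)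
      (f := fun p : ℝ × S => (p.1, p.2, y)) (measurable_gap hf) (by fun_prop)
  · simp only [Function.uncurry, abs_abs]
    exact gap_le hC p.1 p.2 y

theorem measurable_integral_gap (hf : Measurable f) (P : Measure S) [IsProbabilityMeasure P]
    (y : S) : Measurable fun t => ∫ z, |semigroup Q t f z - semigroup Q t f y| ∂P := by
  have h1 : Measurable fun p : ℝ × S => |semigroup Q p.1 f p.2 - semigroup Q p.1 f y| :=
    Measurable.comp
      (g := fun p : ℝ × S × S => |semigroup Q p.1 f p.2.1 - semigroup Q p.1 f p.2.2|)
      (f := fun p : ℝ × S => (p.1, p.2, y)) (measurable_gap hf) (by fun_prop)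
  exact h1.stronglyMeasurable.integral_prod_right.measurable

theorem abs_integral_sub_le (hf : Measurable f) (hC : ∀ x, |f x| ≤ C) (P : Measure S)
    [IsProbabilityMeasure P] (t : ℝ) (y : S) :
    |∫ z, semigroup Q t f z ∂P - semigroup Q t f y| ≤
      ∫ z, |semigroup Q t f z - semigroup Q t f y| ∂P := by
  have h1 : ∫ z, semigroup Q t f z ∂P - semigroup Q t f y =
      ∫ z, (semigroup Q t f z - semigroup Q t f y) ∂P := by
    rw [integral_sub (integrable_of_bounded _ (measurable_semigroup_apply Q hf t)
      (abs_semigroup_le Q hC t)) (integrable_const _)]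
    simp
  rw [h1]
  exact abs_integral_le_integral_abs

namespace IsBirthDeath

variable (h : IsBirthDeath Q sz a b β)
include h

/-- In generator form the drift of the pair is at most -1. Birth rates are affine, so the pair's
total birth rate depends only on the total size, and each death rate is at least linear; this
reduces the claim to `lyapunovIncrement_drift`. -/
theorem lyapunov_drift {x y : S} (hxy : sz x + sz y ≠ 0) :
    totalRate a b β (sz x) * ∫ z, lyapunov a b (sz z + sz y) ∂jumpKernel Q x +
      totalRate a b β (sz y) * ∫ z, lyapunov a b (sz z + sz x) ∂jumpKernel Q y ≤
    (totalRate a b β (sz x) + totalRate a b β (sz y)) * lyapunov a b (sz x + sz y) - 1 := by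
  rw [h.totalRate_mul_integral_size x fun n => lyapunov a b (n + sz y),
    h.totalRate_mul_integral_size y fun n => lyapunov a b (n + sz x)]
  obtain ⟨s, hs⟩ : ∃ s, sz x + sz y = s + 1 := Nat.exists_eq_succ_of_ne_zero hxy
  have hup : ∀ n, lyapunov a b (n + 1) = lyapunov a b n + lyapunovIncrement a b n := fun n =>
    Finset.sum_range_succ _ _
  have hdown : ∀ m n : ℕ, m + n = s + 1 →
      ((m : ℝ) + β * m * (m - 1)) * lyapunov a b (m - 1 + n) =
      ((m : ℝ) + β * m * (m - 1)) * (lyapunov a b (s + 1) - lyapunovIncrement a b s) := by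
    intro m n hmn
    rcases Nat.eq_zero_or_pos m with h0 | h0
    · simp [h0]
    · rw [show m - 1 + n = s by omega, hup]
      ring
  rw [hdown _ _ hs, hdown _ _ ((add_comm _ _).trans hs), show sz x + 1 + sz y = s + 1 + 1 by omega,
    show sz y + 1 + sz x = s + 1 + 1 by omega, hup (s + 1), hs]
  have hdrift := lyapunovIncrement_drift h.pos_a h.nonneg_b h.b_lt_one s
  have h1 := one_le_lyapunovIncrement h.pos_a h.nonneg_b s
  have hdx := h.le_deathRate (sz x)
  have hdy := h.le_deathRate (sz y)
  have hs' : (sz x : ℝ) + sz y = s + 1 := by exact_mod_cast hs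
  have hm : ((s : ℝ) + 1) * lyapunovIncrement a b s ≤
      ((sz x + β * sz x * (sz x - 1)) + (sz y + β * sz y * (sz y - 1))) *
        lyapunovIncrement a b s :=
    mul_le_mul_of_nonneg_right (by linarith) (zero_le_one.trans h1)
  have hbirth : (2 * a + b * (s + 1)) = (a + b * sz x) + (a + b * sz y) := by
    rw [← hs']
    ring
  rw [hbirth] at hdrift
  unfold totalRate
  linarith

variable (hf : Measurable f) (hC : ∀ x, |f x| ≤ C)
include hf hC

/-- The first-jump inequality for a pair of independent processes. -/
theorem mul_totalGap_le {T : ℝ} (hT : 0 ≤ T) (x y : S) :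
    (totalRate a b β (sz x) + totalRate a b β (sz y)) * totalGap Q f T x y ≤ 2 * C +
      totalRate a b β (sz x) * ∫ z, totalGap Q f T z y ∂jumpKernel Q x +
      totalRate a b β (sz y) * ∫ z, totalGap Q f T z x ∂jumpKernel Q y := by
  have hrx := h.totalRate_pos (sz x)
  have hry := h.totalRate_pos (sz y)
  set r := totalRate a b β (sz x)
  set r' := totalRate a b β (sz y)
  have hcx : ContinuousOn (fun t => semigroup Q t f x) (Icc 0 T) :=
    (h.continuousOn_semigroup hf hC x).mono Icc_subset_Ici_self
  have hcy : ContinuousOn (fun t => semigroup Q t f y) (Icc 0 T) :=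
    (h.continuousOn_semigroup hf hC y).mono Icc_subset_Ici_self
  have hjx : ContinuousOn (jumpMean Q f x) (Icc 0 T) :=
    (h.continuousOn_jumpMean hf hC x).mono Icc_subset_Ici_self
  have hjy : ContinuousOn (jumpMean Q f y) (Icc 0 T) :=
    (h.continuousOn_jumpMean hf hC y).mono Icc_subset_Ici_self
  -- The gap p satisfies p' = R - (r + r') p, where `R` collects the mean gaps after a jump of one
  -- of the two copies.
  let R : ℝ → ℝ := fun t => r * (jumpMean Q f x t - semigroup Q t f y) +
    r' * (semigroup Q t f x - jumpMean Q f y t)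
  have hRc : ContinuousOn R (Icc 0 T) := by
    exact (continuousOn_const.mul (hjx.sub hcy)).add (continuousOn_const.mul (hcx.sub hjy))
  have hmain := mul_integral_abs_le (c := r + r') (R := R)
    (p := fun t => semigroup Q t f x - semigroup Q t f y) (by positivity) hT (hcx.sub hcy)
    hRc.integrableOn_Icc fun t ht => by
      refine ((h.hasDerivAt_semigroup hf hC x ht.1).sub
        (h.hasDerivAt_semigroup hf hC y ht.1)).congr_deriv ?_
      simp only [R]
      ring
  have hint : ∀ w v : S, Integrable (fun t => ∫ z, |semigroup Q t f z - semigroup Q t f v|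
      ∂jumpKernel Q w) (volume.restrict (Ioc 0 T)) := fun w v =>
    integrable_of_bounded (C := 2 * C) _ (measurable_integral_gap hf _ v) fun t =>
      abs_integral_le_of_bounded _ fun z => by
        rw [abs_abs]
        exact gap_le hC t z v
  have hRle : ∫ t in Ioc 0 T, |R t| ≤ r * ∫ z, totalGap Q f T z y ∂jumpKernel Q x +
      r' * ∫ z, totalGap Q f T z x ∂jumpKernel Q y := by
    rw [← integral_integral_gap hf hC, ← integral_integral_gap hf hC, ← integral_const_mul,
      ← integral_const_mul, ← integral_add ((hint x y).const_mul r) ((hint y x).const_mul r')]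
    refine integral_mono ((hRc.abs.integrableOn_Icc).mono_set Ioc_subset_Icc_self)
      (((hint x y).const_mul r).add ((hint y x).const_mul r')) fun t => ?_
    have h1 := abs_integral_sub_le (Q := Q) hf hC (jumpKernel Q x) t y
    have h2 := abs_integral_sub_le (Q := Q) hf hC (jumpKernel Q y) t x
    calc |R t| ≤ |r * (jumpMean Q f x t - semigroup Q t f y)| +
          |r' * (semigroup Q t f x - jumpMean Q f y t)| := abs_add_le _ _
      _ = r * |jumpMean Q f x t - semigroup Q t f y| +
          r' * |jumpMean Q f y t - semigroup Q t f x| := by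
        rw [abs_mul, abs_mul, abs_of_pos hrx, abs_of_pos hry, abs_sub_comm (semigroup Q t f x)]
      _ ≤ _ := by
        unfold jumpMean
        gcongr
  have h0 := gap_le (Q := Q) hC 0 x y
  unfold totalGap at hRle ⊢
  linarith

/-- The integrated distance of the expectations for two initial states is bounded uniformly in
time by a multiple of the total size of the initial states. -/
theorem totalGap_le_size {T : ℝ} (hT : 0 ≤ T) (x y : S) :
    totalGap Q f T x y ≤ (2 * C + 1) * lyapunovIncrement a b 0 * (sz x + sz y) := by
  have ha := h.pos_a
  have hb := h.nonneg_b
  have hC0 : 0 ≤ C := (abs_nonneg _).trans (hC x)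
  have hgap : ∀ v w, Integrable (fun z => totalGap Q f T z v) (jumpKernel Q w) := fun v w =>
    integrable_of_bounded (C := 2 * C * T) _
      (Measurable.comp (g := fun p : S × S => totalGap Q f T p.1 p.2) (f := fun z => (z, v))
        (measurable_totalGap hf T) (by fun_prop)) fun z => by
      rw [abs_of_nonneg (totalGap_nonneg T z v)]
      exact totalGap_le hC hT z v
  -- The crude bound 2CT depends on the horizon, but it serves only to confine positive values to
  -- finitely many sizes; it does not enter the final estimate.
  obtain ⟨N, hN⟩ := exists_nat_gt (2 * C * T)
  obtain ⟨R, hR0, hR⟩ := exists_forall_lt_le (totalRate a b β) (fun n => (h.totalRate_pos n).le) N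
  have key : ∀ p : S × S,
      totalGap Q f T p.1 p.2 - (2 * C + 1) * lyapunov a b (sz p.1 + sz p.2) ≤ 0 := by
    have hl : ∀ n, 0 ≤ lyapunov a b n := fun n => n.cast_nonneg.trans (le_lyapunov ha hb n)
    refine nonpos_of_le_sub (B := 2 * C * T) (δ := 1 / (R + R + 1)) (by positivity)
      (fun p => ?_) fun M hM p hp => ?_
    · have h1 := totalGap_le (Q := Q) hC hT p.1 p.2
      have h2 := mul_nonneg (by positivity : 0 ≤ 2 * C + 1) (hl (sz p.1 + sz p.2))
      linarith
    · obtain ⟨x, y⟩ := p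
      dsimp only at hp ⊢
      -- Two empty states coincide, so their gap vanishes; this is the only pair where the drift
      -- estimate is unavailable.
      have hne : sz x + sz y ≠ 0 := by
        intro h0
        have hx : sz x = 0 := by omega
        have hy : sz y = 0 := by omega
        have hxy := h.eq_of_size_eq_zero x y hx hy
        subst hxy
        simp [totalGap, lyapunov, hx] at hp
      have hlt : sz x + sz y < N := by
        have h1 := totalGap_le (Q := Q) hC hT x y
        have h2 := le_lyapunov ha hb (sz x + sz y)
        have h3 : ((sz x + sz y : ℕ) : ℝ) < N := by nlinarith [hl (sz x + sz y)]
        exact_mod_cast h3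
      have hrx := h.totalRate_pos (sz x)
      have hry := h.totalRate_pos (sz y)
      have hrR := hR (sz x) (by omega)
      have hrR' := hR (sz y) (by omega)
      have hstep := h.mul_totalGap_le hf hC hT x y
      have hdrift := h.lyapunov_drift hne
      have hmean : ∀ v w, ∫ z, totalGap Q f T z v ∂jumpKernel Q w ≤
          M + (2 * C + 1) * ∫ z, lyapunov a b (sz z + sz v) ∂jumpKernel Q w := by
        intro v w
        have hI := h.integrable_size w fun n => lyapunov a b (n + sz v)
        calc ∫ z, totalGap Q f T z v ∂jumpKernel Q w ≤
              ∫ z, (M + (2 * C + 1) * lyapunov a b (sz z + sz v)) ∂jumpKernel Q w :=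
              integral_mono (hgap v w) ((integrable_const M).add (hI.const_mul _)) fun z => by
                have := hM (z, v)
                dsimp only at this ⊢
                linarith
          _ = _ := by
              rw [integral_add (integrable_const M) (hI.const_mul _), integral_const_mul]
              simp
      have hx' := mul_le_mul_of_nonneg_left (hmean y x) hrx.le
      have hy' := mul_le_mul_of_nonneg_left (hmean x y) hry.le
      have hd' := mul_le_mul_of_nonneg_left hdrift (by positivity : 0 ≤ 2 * C + 1)
      set r := totalRate a b β (sz x)
      set r' := totalRate a b β (sz y)
      set D := totalGap Q f T x y - (2 * C + 1) * lyapunov a b (sz x + sz y) with hD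
      -- The drift contributes -(2C + 1) against the initial gap 2C. The additional 1 in the
      -- constant leaves a strict margin, even for C = 0.
      have hfin : (r + r') * D ≤ (r + r') * M - 1 := by
        rw [hD]
        linarith
      have h5 : D ≤ M - 1 / (r + r') := by
        have h6 : M - 1 / (r + r') = ((r + r') * M - 1) / (r + r') := by field_simp
        rw [h6, le_div_iff₀ (by positivity)]
        linarith
      refine h5.trans ?_
      have : 1 / (R + R + 1) ≤ 1 / (r + r') :=
        one_div_le_one_div_of_le (by positivity) (by linarith)
      linarith
  have h1 := key (x, y)
  have h2 := mul_le_mul_of_nonneg_left (lyapunov_le ha hb (sz x + sz y))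
    (by positivity : 0 ≤ 2 * C + 1)
  push_cast at h2
  dsimp only at h1
  linarith

end IsBirthDeath

end Coupling

/-! ### The equilibrium of the birth-death process on ℕ -/

/-- Global balance of `P` with respect to the rates `Q`. -/
def IsBalanced {S : Type*} [MeasurableSpace S] (Q : Kernel S S) (P : Measure S) : Prop :=
  ∀ g : S → ℝ≥0∞, Measurable g → ∫⁻ x, ∫⁻ y, g y ∂Q x ∂P = ∫⁻ x, Q x univ * g x ∂P

section Stationary

variable {a b β : ℝ}

theorem isBirthDeath_birthDeathRates (ha : 0 < a) (hb : 0 ≤ b) (hb1 : b < 1) (hβ : 0 ≤ β) :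
    IsBirthDeath (birthDeathRates a b β) id a b β where
  pos_a := ha
  nonneg_b := hb
  b_lt_one := hb1
  nonneg_β := hβ
  measurable_size := measurable_id
  map_size _ := Measure.map_id
  eq_of_size_eq_zero _ _ hx hy := hx.trans hy.symm

theorem lintegral_birthDeathRates (n : ℕ) (g : ℕ → ℝ≥0∞) :
    ∫⁻ m, g m ∂birthDeathRates a b β n = ENNReal.ofReal (a + b * n) * g (n + 1) +
      ENNReal.ofReal (n + β * n * (n - 1)) * g (n - 1) := by
  have h : birthDeathRates a b β n = ENNReal.ofReal (a + b * n) • Measure.dirac (n + 1) +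
    ENNReal.ofReal (n + β * n * (n - 1)) • Measure.dirac (n - 1) := rfl
  rw [h, lintegral_add_measure, lintegral_smul_measure, lintegral_smul_measure, lintegral_dirac,
    lintegral_dirac]
  rfl

/-- The unnormalized weights of the invariant distribution of the birth-death process. -/
def weight (a b β : ℝ) : ℕ → ℝ
  | 0 => 1
  | n + 1 => weight a b β n * (a + b * n) / ((n + 1 : ℕ) + β * (n + 1 : ℕ) * ((n + 1 : ℕ) - 1))

/-- The invariant distribution of the birth-death process. -/
def stationary (a b β : ℝ) : Measure ℕ :=
  Measure.sum fun n => ENNReal.ofReal (weight a b β n / ∑' k, weight a b β k) • Measure.dirac n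

theorem lintegral_stationary (g : ℕ → ℝ≥0∞) :
    ∫⁻ n, g n ∂stationary a b β =
      ∑' n, ENNReal.ofReal (weight a b β n / ∑' k, weight a b β k) * g n := by
  simp only [stationary, lintegral_sum_measure, lintegral_smul_measure, lintegral_dirac,
    smul_eq_mul]

theorem deathRate_succ_pos (hβ : 0 ≤ β) (n : ℕ) :
    (0 : ℝ) < (n + 1 : ℕ) + β * (n + 1 : ℕ) * ((n + 1 : ℕ) - 1) := by
  push_cast
  rw [add_sub_cancel_right]
  positivity

variable (ha : 0 < a) (hb : 0 ≤ b) (hβ : 0 ≤ β)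
include ha hb hβ

theorem weight_pos (n : ℕ) : 0 < weight a b β n := by
  induction n with
  | zero => exact one_pos
  | succ n ih =>
    have := deathRate_succ_pos hβ n
    rw [weight]
    positivity

/-- Second moments are required because the total rate is quadratic in the size when β > 0. The
ratio test applies with any ρ strictly between `b` and 1. -/
theorem summable_weight_mul_sq (hb1 : b < 1) :
    Summable fun n : ℕ => weight a b β n * (1 + n) ^ 2 := by
  obtain ⟨ρ, hρ, hρ1⟩ := exists_between hb1
  refine summable_of_ratio_norm_eventually_le hρ1 ?_
  -- With m = n + 1, (a + bn)(m + 1)² is at most bm³ + (4a + 3b)m²; beyond this threshold the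
  -- quadratic term is absorbed by (ρ - b)m³.
  obtain ⟨N, hN⟩ := exists_nat_gt ((4 * a + 3 * b) / (ρ - b))
  filter_upwards [Filter.eventually_ge_atTop N] with n hn
  have hw := weight_pos ha hb hβ n
  have hw' := weight_pos ha hb hβ (n + 1)
  have hd := deathRate_succ_pos hβ n
  rw [Real.norm_of_nonneg (by positivity), Real.norm_of_nonneg (by positivity)]
  have hm : (4 * a + 3 * b) ≤ (ρ - b) * (n + 1) := by
    rw [div_lt_iff₀ (by linarith)] at hN
    have : (N : ℝ) ≤ n := by exact_mod_cast hn
    nlinarith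
  have hn0 : (0 : ℝ) ≤ n := n.cast_nonneg
  have hpoly : (a + b * n) * (1 + (n + 1)) ^ 2 ≤ ρ * (1 + n) ^ 2 * (n + 1) := by
    have h1 : (4 * a + 3 * b) * ((n : ℝ) + 1) ^ 2 ≤ (ρ - b) * (n + 1) * (n + 1) ^ 2 :=
      mul_le_mul_of_nonneg_right hm (by positivity)
    have h2 : (a + b * n) * (1 + ((n : ℝ) + 1)) ^ 2 ≤
        b * (n + 1) ^ 3 + (4 * a + 3 * b) * (n + 1) ^ 2 := by
      have e : b * ((n : ℝ) + 1) ^ 3 + (4 * a + 3 * b) * (n + 1) ^ 2 -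
          (a + b * n) * (1 + (n + 1)) ^ 2 =
          a * (3 * n ^ 2 + 4 * n) + b * (2 * n ^ 2 + 5 * n + 4) := by ring
      have : 0 ≤ a * (3 * (n : ℝ) ^ 2 + 4 * n) + b * (2 * (n : ℝ) ^ 2 + 5 * n + 4) := by positivity
      linarith
    nlinarith
  have hdle : ((n : ℝ) + 1) ≤ (n + 1 : ℕ) + β * (n + 1 : ℕ) * ((n + 1 : ℕ) - 1) := by
    push_cast
    rw [add_sub_cancel_right]
    have : 0 ≤ β * ((n : ℝ) + 1) * n := by positivity
    linarith
  rw [weight, div_mul_eq_mul_div, div_le_iff₀ hd]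
  push_cast at hdle ⊢
  have h3 : ρ * (1 + (n : ℝ)) ^ 2 * (n + 1) ≤
      ρ * (1 + n) ^ 2 * ((n + 1) + β * (n + 1) * (n + 1 - 1)) :=
    mul_le_mul_of_nonneg_left hdle (mul_nonneg (hb.trans hρ.le) (by positivity))
  have h4 := mul_le_mul_of_nonneg_left (hpoly.trans h3) hw.le
  linarith

theorem summable_weight (hb1 : b < 1) : Summable (weight a b β) := by
  refine Summable.of_nonneg_of_le (fun n => (weight_pos ha hb hβ n).le) (fun n => ?_)
    (summable_weight_mul_sq ha hb hβ hb1)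
  have : (1 : ℝ) ≤ (1 + n) ^ 2 := one_le_pow₀ (by simp)
  nlinarith [weight_pos ha hb hβ n]

theorem tsum_weight_pos (hb1 : b < 1) : 0 < ∑' k, weight a b β k :=
  (summable_weight ha hb hβ hb1).tsum_pos (fun n => (weight_pos ha hb hβ n).le) 0
    (weight_pos ha hb hβ 0)

theorem isProbabilityMeasure_stationary (hb1 : b < 1) :
    IsProbabilityMeasure (stationary a b β) := by
  have hZ := tsum_weight_pos ha hb hβ hb1
  refine ⟨?_⟩
  rw [← lintegral_one, lintegral_stationary]
  simp only [mul_one]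
  rw [← ENNReal.ofReal_tsum_of_nonneg
    (fun n => div_nonneg (weight_pos ha hb hβ n).le hZ.le)
    ((summable_weight ha hb hβ hb1).div_const _), tsum_div_const, div_self hZ.ne',
    ENNReal.ofReal_one]

theorem integrable_sq_stationary (hb1 : b < 1) :
    Integrable (fun n : ℕ => (1 + (n : ℝ)) ^ 2) (stationary a b β) := by
  have hZ := tsum_weight_pos ha hb hβ hb1
  refine ⟨by fun_prop, ?_⟩
  rw [hasFiniteIntegral_iff_ofReal (ae_of_all _ fun n => by positivity), lintegral_stationary]
  have h1 : ∀ n : ℕ, ENNReal.ofReal (weight a b β n / ∑' k, weight a b β k) *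
      ENNReal.ofReal ((1 + (n : ℝ)) ^ 2) =
      ENNReal.ofReal (weight a b β n * (1 + n) ^ 2 / ∑' k, weight a b β k) := fun n => by
    rw [← ENNReal.ofReal_mul (div_nonneg (weight_pos ha hb hβ n).le hZ.le)]
    congr 1
    ring
  simp only [h1]
  exact ((summable_weight_mul_sq ha hb hβ hb1).div_const _).tsum_ofReal_lt_top

theorem integrable_natCast_stationary (hb1 : b < 1) :
    Integrable (fun n : ℕ => (n : ℝ)) (stationary a b β) := by
  refine (integrable_sq_stationary ha hb hβ hb1).mono' (by fun_prop) (ae_of_all _ fun n => ?_)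
  rw [Real.norm_natCast]
  nlinarith [(n.cast_nonneg : (0 : ℝ) ≤ n)]

theorem integrable_totalRate_stationary (hb1 : b < 1) :
    Integrable (totalRate a b β) (stationary a b β) := by
  refine ((integrable_sq_stationary ha hb hβ hb1).const_mul (a + b + 1 + β)).mono' (by fun_prop)
    (ae_of_all _ fun n => ?_)
  have hn : (0 : ℝ) ≤ n := n.cast_nonneg
  rw [Real.norm_of_nonneg ((isBirthDeath_birthDeathRates ha hb hb1 hβ).totalRate_pos n).le,
    totalRate]
  have h1 : (n : ℝ) ≤ (1 + n) ^ 2 := by nlinarith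
  have h2 : (1 : ℝ) ≤ (1 + n) ^ 2 := by nlinarith
  have h3 : (n : ℝ) * (n - 1) ≤ (1 + n) ^ 2 := by nlinarith
  nlinarith [mul_le_mul_of_nonneg_left h1 hb, mul_le_mul_of_nonneg_left h2 ha.le,
    mul_le_mul_of_nonneg_left h3 hβ]

/-- The weights satisfy detailed balance between n and n + 1. Shifting the index exchanges the birth
and death sums, with no boundary term because the death rate at 0 is zero. -/
theorem isBalanced_stationary (hb1 : b < 1) :
    IsBalanced (birthDeathRates a b β) (stationary a b β) := by
  intro g _
  have hZ := tsum_weight_pos ha hb hβ hb1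
  have h := isBirthDeath_birthDeathRates ha hb hb1 hβ
  simp only [lintegral_birthDeathRates, h.rate_univ, totalRate, id]
  rw [lintegral_stationary, lintegral_stationary]
  set c : ℕ → ℝ≥0∞ := fun n => ENNReal.ofReal (weight a b β n / ∑' k, weight a b β k)
  set α : ℕ → ℝ≥0∞ := fun n => ENNReal.ofReal (a + b * n)
  set δ : ℕ → ℝ≥0∞ := fun n => ENNReal.ofReal (n + β * n * (n - 1))
  have hδ0 : δ 0 = 0 := by simp [δ]
  have hdet : ∀ n, c n * α n = c (n + 1) * δ (n + 1) := by
    intro n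
    have hd := deathRate_succ_pos hβ n
    simp only [c, α, δ]
    rw [← ENNReal.ofReal_mul (div_nonneg (weight_pos ha hb hβ n).le hZ.le),
      ← ENNReal.ofReal_mul (div_nonneg (weight_pos ha hb hβ (n + 1)).le hZ.le), weight]
    rw [div_right_comm, div_mul_eq_mul_div, div_mul_cancel₀ _ hd.ne']
  have hup : ∑' n, c n * α n * g (n + 1) = ∑' n, c n * δ n * g n := by
    rw [tsum_eq_zero_add' (f := fun n => c n * δ n * g n) ENNReal.summable]
    simp only [hδ0, mul_zero, zero_mul, zero_add, hdet]
  have hdown : ∑' n, c n * δ n * g (n - 1) = ∑' n, c n * α n * g n := by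
    rw [tsum_eq_zero_add' (f := fun n => c n * δ n * g (n - 1)) ENNReal.summable]
    simp only [hδ0, mul_zero, zero_mul, zero_add, hdet, Nat.add_sub_cancel]
  calc ∑' n, c n * (α n * g (n + 1) + δ n * g (n - 1))
      = ∑' n, c n * α n * g (n + 1) + ∑' n, c n * δ n * g (n - 1) := by
        rw [← ENNReal.tsum_add]
        exact tsum_congr fun n => by ring
    _ = ∑' n, c n * (ENNReal.ofReal ((a + b * n) + (n + β * n * (n - 1))) * g n) := by
        rw [hup, hdown, ← ENNReal.tsum_add]
        refine tsum_congr fun n => ?_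
        rw [ENNReal.ofReal_add (h.birthRate_pos n).le (h.deathRate_nonneg n)]
        ring

end Stationary

/-! ### Independent samples and balance on configurations -/

section PointProcess

variable {Γ : Type*}

theorem range_succ_map_seqCons (n : ℕ) (x : Γ) (u : ℕ → Γ) :
    (Multiset.range (n + 1)).map (seqCons x u) = x ::ₘ (Multiset.range n).map u := by
  have : Multiset.range (n + 1) = 0 ::ₘ (Multiset.range n).map Nat.succ := by
    simp only [Multiset.range, List.range_succ_eq_map]
    rfl
  rw [this, Multiset.map_cons, Multiset.map_map]
  rfl

variable [MeasurableSpace Γ]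

theorem measurable_cons_left (x : Γ) : Measurable fun ξ : Multiset Γ => x ::ₘ ξ :=
  measurable_cons.comp (measurable_id.prodMk measurable_const)

theorem measurable_comp_cons_left (x : Γ) {g : Multiset Γ → ℝ≥0∞} (hg : Measurable g) :
    Measurable fun η => g (x ::ₘ η) :=
  hg.comp (measurable_cons_left x)

theorem measurable_cons_right (ξ : Multiset Γ) : Measurable fun x : Γ => x ::ₘ ξ :=
  measurable_cons.comp (measurable_const.prodMk measurable_id)

open Classical in
theorem lintegral_deathMeasure (ξ : Multiset Γ) {g : Multiset Γ → ℝ≥0∞} (hg : Measurable g) :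
    ∫⁻ η, g η ∂deathMeasure ξ = (ξ.map fun x => g (ξ.erase x)).sum := by
  have key : ∀ s : Multiset Γ, ∫⁻ η, g η ∂(s.map fun x => Measure.dirac (ξ.erase x)).sum =
      (s.map fun x => g (ξ.erase x)).sum := by
    intro s
    induction s using Multiset.induction_on with
    | empty => simp
    | cons x s ih => simp [ih, lintegral_dirac' _ hg]
  exact key ξ

open Classical in
theorem integrable_deathMeasure_and_integral (ξ : Multiset Γ) {g : Multiset Γ → ℝ}
    (hg : Measurable g) : Integrable g (deathMeasure ξ) ∧
      ∫ η, g η ∂deathMeasure ξ = (ξ.map fun x => g (ξ.erase x)).sum := by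
  have key : ∀ s : Multiset Γ, Integrable g (s.map fun x => Measure.dirac (ξ.erase x)).sum ∧
      ∫ η, g η ∂(s.map fun x => Measure.dirac (ξ.erase x)).sum =
      (s.map fun x => g (ξ.erase x)).sum := by
    intro s
    induction s using Multiset.induction_on with
    | empty => simp
    | cons x s ih =>
      have hd : Integrable g (Measure.dirac (ξ.erase x)) :=
        integrable_dirac' hg.stronglyMeasurable (by simp)
      rw [Multiset.map_cons, Multiset.sum_cons, Multiset.map_cons, Multiset.sum_cons,
        integral_add_measure hd ih.1, ih.2, integral_dirac' _ _ hg.stronglyMeasurable]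
      exact ⟨hd.add_measure ih.1, rfl⟩
  exact key ξ

theorem lintegral_deathMeasure_cons (x : Γ) (ξ : Multiset Γ) {g : Multiset Γ → ℝ≥0∞}
    (hg : Measurable g) :
    ∫⁻ η, g η ∂deathMeasure (x ::ₘ ξ) = g ξ + ∫⁻ η, g (x ::ₘ η) ∂deathMeasure ξ := by
  classical
  rw [lintegral_deathMeasure _ hg, lintegral_deathMeasure _
    (measurable_comp_cons_left x hg), Multiset.map_cons, Multiset.sum_cons,
    Multiset.erase_cons_head]
  congr 2
  refine Multiset.map_congr rfl fun y hy => ?_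
  rw [Multiset.erase_cons_tail_of_mem hy]

/-- The law of `∑_{i=1}^n δ_{U_i}` for independent `U_i` with law `μ`. -/
def sampleLaw (μ : Measure Γ) (n : ℕ) : Measure (Multiset Γ) :=
  (Measure.infinitePi fun _ : ℕ => μ).map fun u => (Multiset.range n).map u

theorem measurable_sample (n : ℕ) :
    Measurable fun u : ℕ → Γ => (Multiset.range n).map u :=
  measurable_pointProcess.comp measurable_prodMk_left

/-- The sample size is deterministic, so size-dependent rates can be pulled out of the integral as
constants. -/
theorem lintegral_sampleLaw_card (μ : Measure Γ) (n : ℕ) {F : ℕ → Multiset Γ → ℝ≥0∞}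
    (hF : Measurable fun ξ => F (Multiset.card ξ) ξ) (hF' : Measurable (F n)) :
    ∫⁻ ξ, F (Multiset.card ξ) ξ ∂sampleLaw μ n = ∫⁻ ξ, F n ξ ∂sampleLaw μ n := by
  rw [sampleLaw, lintegral_map hF (measurable_sample n), lintegral_map hF' (measurable_sample n)]
  simp

theorem measurable_lintegral_deathMeasure {g : Multiset Γ → ℝ≥0∞} (hg : Measurable g) :
    Measurable fun ξ => ∫⁻ η, g η ∂deathMeasure ξ :=
  (Measure.measurable_lintegral hg).comp measurable_deathMeasure

variable (μ : Measure Γ) [IsProbabilityMeasure μ]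

instance (n : ℕ) : IsProbabilityMeasure (sampleLaw μ n) :=
  Measure.isProbabilityMeasure_map (measurable_sample n).aemeasurable

theorem lintegral_sampleLaw_succ (n : ℕ) {g : Multiset Γ → ℝ≥0∞} (hg : Measurable g) :
    ∫⁻ ξ, g ξ ∂sampleLaw μ (n + 1) = ∫⁻ x, ∫⁻ ξ, g (x ::ₘ ξ) ∂sampleLaw μ n ∂μ := by
  have hgs : Measurable fun u : ℕ → Γ => g ((Multiset.range (n + 1)).map u) :=
    hg.comp (measurable_sample (n + 1))
  have hgs' : Measurable fun p : Γ × (ℕ → Γ) =>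
      g ((Multiset.range (n + 1)).map (seqCons p.1 p.2)) := hgs.comp measurable_seqCons
  rw [sampleLaw, lintegral_map hg (measurable_sample (n + 1)), infinitePi_eq_map_seqCons,
    lintegral_map hgs measurable_seqCons, lintegral_prod _ hgs'.aemeasurable]
  refine lintegral_congr fun x => ?_
  rw [sampleLaw, lintegral_map (measurable_comp_cons_left x hg) (measurable_sample n)]
  simp only [range_succ_map_seqCons]

/-- Removing any one of n independent points leaves n - 1 independent points. In the induction
either the newly added point is removed or it is kept and one of the others goes. -/
theorem lintegral_deathMeasure_sampleLaw (n : ℕ) {g : Multiset Γ → ℝ≥0∞} (hg : Measurable g) :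
    ∫⁻ ξ, ∫⁻ η, g η ∂deathMeasure ξ ∂sampleLaw μ n = n * ∫⁻ ξ, g ξ ∂sampleLaw μ (n - 1) := by
  induction n generalizing g with
  | zero =>
    rw [sampleLaw, lintegral_map (measurable_lintegral_deathMeasure hg) (measurable_sample 0)]
    simp [deathMeasure]
  | succ n ih =>
    rw [lintegral_sampleLaw_succ μ n (measurable_lintegral_deathMeasure hg)]
    have h1 : ∀ x, ∫⁻ ξ, ∫⁻ η, g η ∂deathMeasure (x ::ₘ ξ) ∂sampleLaw μ n =
        ∫⁻ ξ, g ξ ∂sampleLaw μ n + n * ∫⁻ ξ, g (x ::ₘ ξ) ∂sampleLaw μ (n - 1) := by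
      intro x
      simp only [lintegral_deathMeasure_cons _ _ hg]
      rw [lintegral_add_left hg, ih (measurable_comp_cons_left x hg)]
    simp only [h1]
    rw [lintegral_add_left measurable_const, lintegral_const, measure_univ, mul_one,
      Nat.add_sub_cancel]
    -- For `n = 0` the truncated predecessor cannot be restored by adding a point, but its
    -- coefficient is zero.
    cases n with
    | zero => simp
    | succ n =>
      rw [lintegral_const_mul' _ _ (ENNReal.natCast_ne_top _), Nat.add_sub_cancel,
        ← lintegral_sampleLaw_succ μ n hg]
      push_cast
      ring

variable {a b β : ℝ}

theorem lintegral_systemRates (ξ : Multiset Γ) {g : Multiset Γ → ℝ≥0∞} (hg : Measurable g) :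
    ∫⁻ η, g η ∂systemRates a b β μ ξ =
      ENNReal.ofReal (a + b * Multiset.card ξ) * ∫⁻ x, g (x ::ₘ ξ) ∂μ +
      ENNReal.ofReal (1 + β * (Multiset.card ξ - 1)) * ∫⁻ η, g η ∂deathMeasure ξ := by
  have h : systemRates a b β μ ξ =
    ENNReal.ofReal (a + b * Multiset.card ξ) • μ.map (fun x => x ::ₘ ξ) +
    ENNReal.ofReal (1 + β * (Multiset.card ξ - 1)) • deathMeasure ξ := rfl
  rw [h, lintegral_add_measure, lintegral_smul_measure, lintegral_smul_measure,
    lintegral_map hg (measurable_cons_right ξ)]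
  rfl

theorem ofReal_deathRate_mul (hβ : 0 ≤ β) (n : ℕ) :
    ENNReal.ofReal (1 + β * (n - 1)) * n = ENNReal.ofReal (n + β * n * (n - 1)) := by
  cases n with
  | zero => simp
  | succ n =>
    have : (0 : ℝ) ≤ 1 + β * ((n + 1 : ℕ) - 1) := by
      push_cast
      rw [add_sub_cancel_right]
      positivity
    rw [← ENNReal.ofReal_natCast, ← ENNReal.ofReal_mul this]
    congr 1
    ring

theorem isBirthDeath_systemRates (ha : 0 < a) (hb : 0 ≤ b) (hb1 : b < 1) (hβ : 0 ≤ β) :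
    IsBirthDeath (systemRates a b β μ) Multiset.card a b β where
  pos_a := ha
  nonneg_b := hb
  b_lt_one := hb1
  nonneg_β := hβ
  measurable_size := measurable_card
  map_size ξ := by
    classical
    refine Measure.ext_of_lintegral _ fun g hg => ?_
    have hgc : Measurable fun η : Multiset Γ => g (Multiset.card η) := hg.comp measurable_card
    rw [lintegral_map hg measurable_card, lintegral_systemRates μ ξ hgc,
      lintegral_deathMeasure ξ hgc, lintegral_birthDeathRates, ← ofReal_deathRate_mul hβ]
    have h1 : (ξ.map fun x => g (Multiset.card (ξ.erase x))).sum =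
        Multiset.card ξ * g (Multiset.card ξ - 1) := by
      rw [Multiset.map_congr rfl fun x hx => by rw [Multiset.card_erase_of_mem hx]]
      simp
    rw [h1]
    simp [mul_assoc]
  eq_of_size_eq_zero ξ η hξ hη := by
    rw [Multiset.card_eq_zero.1 hξ, Multiset.card_eq_zero.1 hη]

theorem lintegral_pointProcessLaw (π : Measure ℕ) [IsProbabilityMeasure π]
    {g : Multiset Γ → ℝ≥0∞} (hg : Measurable g) :
    ∫⁻ ξ, g ξ ∂pointProcessLaw π μ = ∫⁻ n, ∫⁻ ξ, g ξ ∂sampleLaw μ n ∂π := by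
  have hgp : Measurable fun p : ℕ × (ℕ → Γ) => g ((Multiset.range p.1).map p.2) :=
    hg.comp measurable_pointProcess
  rw [pointProcessLaw, lintegral_map hg measurable_pointProcess,
    lintegral_prod _ hgp.aemeasurable]
  refine lintegral_congr fun n => ?_
  rw [sampleLaw, lintegral_map hg (measurable_sample n)]

instance (π : Measure ℕ) [IsProbabilityMeasure π] : IsProbabilityMeasure (pointProcessLaw π μ) :=
  Measure.isProbabilityMeasure_map measurable_pointProcess.aemeasurable

theorem pointProcessLaw_map_card (π : Measure ℕ) [IsProbabilityMeasure π] :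
    (pointProcessLaw π μ).map Multiset.card = π := by
  rw [pointProcessLaw, Measure.map_map measurable_card measurable_pointProcess]
  have : Multiset.card ∘ (fun p : ℕ × (ℕ → Γ) => (Multiset.range p.1).map p.2) = Prod.fst := by
    ext p
    simp
  rw [this, Measure.map_fst_prod, measure_univ, one_smul]

/-- Births and deaths carry the law of n independent points to multiples of the laws of n + 1 and n
- 1 independent points. Balance for `g` thus reduces to balance on ℕ for the mean of `g` over
samples of a given size. -/
theorem isBalanced_pointProcessLaw (ha : 0 < a) (hb : 0 ≤ b) (hb1 : b < 1) (hβ : 0 ≤ β)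
    {π : Measure ℕ} [IsProbabilityMeasure π] (hπ : IsBalanced (birthDeathRates a b β) π) :
    IsBalanced (systemRates a b β μ) (pointProcessLaw π μ) := by
  intro g hg
  have h := isBirthDeath_systemRates μ ha hb hb1 hβ
  have hN := isBirthDeath_birthDeathRates ha hb hb1 hβ
  have hQ : Measurable fun ξ => ∫⁻ η, g η ∂systemRates a b β μ ξ := hg.lintegral_kernel
  have hQg : Measurable fun ξ => systemRates a b β μ ξ univ * g ξ :=
    ((systemRates a b β μ).measurable_coe MeasurableSet.univ).mul hg
  rw [lintegral_pointProcessLaw μ π hQ, lintegral_pointProcessLaw μ π hQg]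
  have hbal := hπ (fun n => ∫⁻ ξ, g ξ ∂sampleLaw μ n) (by fun_prop)
  have hcons : Measurable fun ξ : Multiset Γ => ∫⁻ x, g (x ::ₘ ξ) ∂μ :=
    (hg.comp measurable_cons).lintegral_prod_right'
  have hdeath := measurable_lintegral_deathMeasure hg
  convert hbal using 1
  · refine lintegral_congr fun n => ?_
    have hm : ∀ c : ℕ → ℝ≥0∞, Measurable fun ξ : Multiset Γ => c (Multiset.card ξ) := fun c =>
      (Measurable.of_discrete (f := c)).comp measurable_card
    have e := lintegral_sampleLaw_card μ n (F := fun k ξ =>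
      ENNReal.ofReal (a + b * k) * ∫⁻ x, g (x ::ₘ ξ) ∂μ +
      ENNReal.ofReal (1 + β * (k - 1)) * ∫⁻ η, g η ∂deathMeasure ξ)
      (((hm fun k => ENNReal.ofReal (a + b * k)).mul hcons).add
        ((hm fun k => ENNReal.ofReal (1 + β * (k - 1))).mul hdeath))
      ((hcons.const_mul _).add (hdeath.const_mul _))
    simp only [lintegral_systemRates μ _ hg]
    rw [e, lintegral_add_left (hcons.const_mul _), lintegral_const_mul _ hcons,
      lintegral_const_mul _ hdeath, lintegral_deathMeasure_sampleLaw μ n hg,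
      lintegral_birthDeathRates, ← ofReal_deathRate_mul hβ, lintegral_sampleLaw_succ μ n hg,
      lintegral_lintegral_swap (by exact (hg.comp measurable_cons).aemeasurable), mul_assoc]
  · refine lintegral_congr fun n => ?_
    have e := lintegral_sampleLaw_card μ n (F := fun k ξ =>
      ENNReal.ofReal (totalRate a b β k) * g ξ)
      (((Measurable.of_discrete (f := fun k => ENNReal.ofReal (totalRate a b β k))).comp
        measurable_card).mul hg) (hg.const_mul _)
    simp only [h.rate_univ, hN.rate_univ, id]
    rw [e, lintegral_const_mul _ hg]

end PointProcess

/-! ### Invariance, convergence and the Poisson equation -/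

section Ergodic

variable {S : Type*} [MeasurableSpace S] {Q : Kernel S S} {sz : S → ℕ} {a b β C : ℝ} {f : S → ℝ}
  {P : Measure S}

theorem measurable_semigroup_sub (hf : Measurable f) (x : S) (c : ℝ) :
    Measurable fun t => semigroup Q t f x - c :=
  (Measurable.comp (g := fun p : ℝ × S => semigroup Q p.1 f p.2) (f := fun t => (t, x))
    (measurable_semigroup Q hf) (by fun_prop)).sub_const c

/-- The potential of `f`: the integral over time of the deviation of `E f(Z_x(t))` from its
limit. -/
def potential (Q : Kernel S S) (P : Measure S) (f : S → ℝ) (x : S) : ℝ :=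
  ∫ t in Ioi 0, (semigroup Q t f x - ∫ y, f y ∂P)

theorem measurable_potential (hf : Measurable f) : Measurable (potential Q P f) := by
  have hm : Measurable fun p : S × ℝ => semigroup Q p.2 f p.1 - ∫ y, f y ∂P :=
    (Measurable.comp (g := fun p : ℝ × S => semigroup Q p.1 f p.2)
      (f := fun p : S × ℝ => (p.2, p.1)) (measurable_semigroup Q hf) (by fun_prop)).sub_const _
  exact hm.stronglyMeasurable.integral_prod_right'.measurable

theorem abs_indicator_one_le {X : Type*} (A : Set X) (x : X) : |(A.indicator 1 x : ℝ)| ≤ 1 := by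
  by_cases hx : x ∈ A <;> simp [hx]

namespace IsBirthDeath

variable (h : IsBirthDeath Q sz a b β)
include h

theorem measurable_totalRate_size : Measurable fun x => totalRate a b β (sz x) :=
  (Measurable.of_discrete (f := totalRate a b β)).comp h.measurable_size

theorem integral_balance_of_nonneg (hbal : IsBalanced Q P) {g : S → ℝ} (hg : Measurable g)
    (hg0 : ∀ x, 0 ≤ g x) (hgC : ∀ x, |g x| ≤ C) :
    ∫ x, totalRate a b β (sz x) * ∫ y, g y ∂jumpKernel Q x ∂P =
      ∫ x, totalRate a b β (sz x) * g x ∂P := by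
  have hr : ∀ x, 0 ≤ totalRate a b β (sz x) := fun x => (h.totalRate_pos _).le
  have hm : Measurable fun x => ∫ y, g y ∂jumpKernel Q x :=
    hg.stronglyMeasurable.integral_kernel.measurable
  rw [integral_eq_lintegral_of_nonneg_ae
      (ae_of_all _ fun x => mul_nonneg (hr x) (integral_nonneg hg0))
      (h.measurable_totalRate_size.mul hm).aestronglyMeasurable,
    integral_eq_lintegral_of_nonneg_ae (ae_of_all _ fun x => mul_nonneg (hr x) (hg0 x))
      (h.measurable_totalRate_size.mul hg).aestronglyMeasurable]
  congr 1
  have hb := hbal (fun y => ENNReal.ofReal (g y)) hg.ennreal_ofReal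
  convert hb using 1
  · refine lintegral_congr fun x => ?_
    have h1 : ∫⁻ y, ENNReal.ofReal (g y) ∂Q x =
        Q x univ * ∫⁻ y, ENNReal.ofReal (g y) ∂jumpKernel Q x := by
      conv_lhs => rw [h.rate_smul_jumpKernel x]
      rw [lintegral_smul_measure, smul_eq_mul]
    rw [h1, ENNReal.ofReal_mul (hr x), h.rate_univ, ofReal_integral_eq_lintegral_ofReal
      (integrable_of_bounded _ hg hgC) (ae_of_all _ hg0)]
  · refine lintegral_congr fun x => ?_
    rw [ENNReal.ofReal_mul (hr x), h.rate_univ]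

theorem hasDerivAt_semigroup_sub (hf : Measurable f) (hC : ∀ x, |f x| ≤ C) (x : S)
    {t : ℝ} (ht : 0 < t) :
    HasDerivAt (fun t => semigroup Q t f x - ∫ y, f y ∂P)
      (totalRate a b β (sz x) * (∫ z, (semigroup Q t f z - ∫ y, f y ∂P) ∂jumpKernel Q x -
        (semigroup Q t f x - ∫ y, f y ∂P))) t := by
  refine ((h.hasDerivAt_semigroup hf hC x ht).sub_const _).congr_deriv ?_
  rw [integral_sub (integrable_of_bounded _ (measurable_semigroup_apply Q hf t)
    (abs_semigroup_le Q hC t)) (integrable_const _)]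
  simp [jumpMean]

variable (hrate : Integrable (fun x => totalRate a b β (sz x)) P)
include hrate

/-- Integrability of the total rate makes the gain and loss terms separately integrable, so balance
for nonnegative functions extends to bounded ones. -/
theorem integral_generator_eq_zero (hbal : IsBalanced Q P) {g : S → ℝ} (hg : Measurable g)
    (hgC : ∀ x, |g x| ≤ C) :
    ∫ x, totalRate a b β (sz x) * (∫ y, g y ∂jumpKernel Q x - g x) ∂P = 0 := by
  have hm : Measurable fun x => ∫ y, g y ∂jumpKernel Q x :=
    hg.stronglyMeasurable.integral_kernel.measurable
  have hmean : ∀ x, |∫ y, g y ∂jumpKernel Q x| ≤ C := fun x => abs_integral_le_of_bounded _ hgC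
  have hi1 : Integrable (fun x => totalRate a b β (sz x) * ∫ y, g y ∂jumpKernel Q x) P :=
    hrate.mul_bdd hm.aestronglyMeasurable (ae_of_all _ hmean)
  have hi2 : Integrable (fun x => totalRate a b β (sz x) * g x) P :=
    hrate.mul_bdd hg.aestronglyMeasurable (ae_of_all _ hgC)
  have hi3 : Integrable (fun x => totalRate a b β (sz x) * C) P := hrate.mul_const C
  -- Adding `C` makes the function nonnegative; the constant contributes equally to both sides and
  -- cancels.
  have hpos := h.integral_balance_of_nonneg (P := P) (g := fun x => g x + C) (C := 2 * C) hbal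
    (hg.add_const C) (fun x => by linarith [(abs_le.1 (hgC x)).1]) fun x => by
      have := abs_le.1 (hgC x)
      rw [abs_le]
      constructor <;> linarith
  have hadd : ∀ x, ∫ y, (g y + C) ∂jumpKernel Q x = ∫ y, g y ∂jumpKernel Q x + C := fun x => by
    rw [integral_add (integrable_of_bounded _ hg hgC) (integrable_const C)]
    simp
  simp only [hadd, mul_add] at hpos
  rw [integral_add hi1 hi3, integral_add hi2 hi3] at hpos
  simp only [mul_sub]
  rw [integral_sub hi1 hi2]
  linarith

variable [IsProbabilityMeasure P]

/-- A balanced distribution is invariant. -/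
theorem integral_semigroup_eq (hbal : IsBalanced Q P) (hf : Measurable f) (hC : ∀ x, |f x| ≤ C)
    {t : ℝ} (ht : 0 ≤ t) : ∫ x, semigroup Q t f x ∂P = ∫ x, f x ∂P := by
  let k : S → ℝ → ℝ := fun x s => totalRate a b β (sz x) * (jumpMean Q f x s - semigroup Q s f x)
  have hkm : Measurable (Function.uncurry k) := by
    have h1 : Measurable fun p : S × ℝ => semigroup Q p.2 f p.1 :=
      Measurable.comp (g := fun p : ℝ × S => semigroup Q p.1 f p.2)
        (f := fun p : S × ℝ => (p.2, p.1)) (measurable_semigroup Q hf) (by fun_prop)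
    exact (h.measurable_totalRate_size.comp measurable_fst).mul ((measurable_jumpMean Q hf).sub h1)
  have hkb : ∀ x s, |k x s| ≤ totalRate a b β (sz x) * (2 * C) := fun x s => by
    rw [abs_mul, abs_of_pos (h.totalRate_pos _)]
    refine mul_le_mul_of_nonneg_left ?_ (h.totalRate_pos _).le
    have h1 := abs_jumpMean_le Q hC x s
    have h2 := abs_semigroup_le Q hC s x
    exact (abs_sub _ _).trans (by linarith)
  have hFTC : ∀ x, semigroup Q t f x - f x = ∫ s in Ioc 0 t, k x s := fun x => by
    rw [← intervalIntegral.integral_of_le ht, intervalIntegral.integral_eq_sub_of_hasDerivAt_of_le ht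
      ((h.continuousOn_semigroup hf hC x).mono Icc_subset_Ici_self)
      (fun s hs => h.hasDerivAt_semigroup hf hC x hs.1)
      (intervalIntegrable_of_bounded (hkm.comp measurable_prodMk_left) (hkb x) 0 t),
      h.semigroup_zero hf hC]
  have hint : Integrable (Function.uncurry k) (P.prod (volume.restrict (Ioc 0 t))) := by
    refine Integrable.mono' ((hrate.mul_const (2 * C)).comp_fst _) hkm.aestronglyMeasurable
      (ae_of_all _ fun p => hkb p.1 p.2)
  have hzero : ∫ x, (semigroup Q t f x - f x) ∂P = 0 := by
    -- After exchanging the integrals, the generator applied to P_s f has mean zero at every time s.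
    simp only [hFTC]
    rw [integral_integral_swap hint]
    have : ∀ s, ∫ x, k x s ∂P = 0 := fun s =>
      h.integral_generator_eq_zero hrate hbal (measurable_semigroup_apply Q hf s)
        (abs_semigroup_le Q hC s)
    simp [this]
  rw [integral_sub (integrable_of_bounded _ (measurable_semigroup_apply Q hf t)
    (abs_semigroup_le Q hC t)) (integrable_of_bounded _ hf hC)] at hzero
  linarith

variable (hsz : Integrable (fun x => (sz x : ℝ)) P) (hbal : IsBalanced Q P)
  (hf : Measurable f) (hC : ∀ x, |f x| ≤ C)
include hsz hbal hf hC

/-- By invariance, the equilibrium mean of `f` is the average of P_t f over starting points drawn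
from `P`. The two-point bound is then averaged, which needs only a finite mean size and gives a
bound free of `T`. -/
theorem integral_Ioc_abs_sub_le {T : ℝ} (hT : 0 ≤ T) (x : S) :
    ∫ t in Ioc 0 T, |semigroup Q t f x - ∫ y, f y ∂P| ≤
      (2 * C + 1) * lyapunovIncrement a b 0 * (∫ y, (sz y : ℝ) ∂P + sz x) := by
  have hmeas := measurable_integral_gap (Q := Q) hf P x
  have hbd : ∀ t, |∫ z, |semigroup Q t f z - semigroup Q t f x| ∂P| ≤ 2 * C := fun t =>
    abs_integral_le_of_bounded _ fun z => by
      rw [abs_abs]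
      exact gap_le hC t z x
  have hPf : |∫ y, f y ∂P| ≤ C := abs_integral_le_of_bounded _ hC
  have hgm : Measurable fun z => totalGap Q f T z x :=
    Measurable.comp (g := fun p : S × S => totalGap Q f T p.1 p.2) (f := fun z => (z, x))
      (measurable_totalGap hf T) (by fun_prop)
  calc ∫ t in Ioc 0 T, |semigroup Q t f x - ∫ y, f y ∂P|
      ≤ ∫ t in Ioc 0 T, ∫ z, |semigroup Q t f z - semigroup Q t f x| ∂P := by
        refine setIntegral_mono_on ?_ (integrable_of_bounded _ hmeas hbd) measurableSet_Ioc
          fun t ht => ?_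
        · refine integrable_of_bounded (C := 2 * C) _
            (measurable_semigroup_sub hf x _).abs fun t => ?_
          have := abs_semigroup_le Q hC t x
          rw [abs_abs]
          exact (abs_sub _ _).trans (by linarith)
        · rw [← h.integral_semigroup_eq hrate hbal hf hC ht.1.le, abs_sub_comm]
          exact abs_integral_sub_le hf hC P t x
    _ = ∫ z, totalGap Q f T z x ∂P := integral_integral_gap hf hC T P x
    _ ≤ ∫ z, (2 * C + 1) * lyapunovIncrement a b 0 * (sz z + sz x) ∂P := by
        refine integral_mono (integrable_of_bounded (C := 2 * C * T) _ hgm fun z => ?_)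
          ((hsz.add (integrable_const _)).const_mul _) fun z => h.totalGap_le_size hf hC hT z x
        rw [abs_of_nonneg (totalGap_nonneg T z x)]
        exact totalGap_le hC hT z x
    _ = _ := by
        rw [integral_const_mul, integral_add hsz (integrable_const _)]
        simp

theorem integrableOn_semigroup_sub (x : S) :
    IntegrableOn (fun t => semigroup Q t f x - ∫ y, f y ∂P) (Ioi 0) := by
  have hPf : |∫ y, f y ∂P| ≤ C := abs_integral_le_of_bounded _ hC
  refine integrableOn_Ioi_of_intervalIntegral_norm_bounded
    ((2 * C + 1) * lyapunovIncrement a b 0 * (∫ y, (sz y : ℝ) ∂P + sz x)) 0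
    (l := Filter.atTop) (b := fun T : ℝ => T) (fun T => ?_) Filter.tendsto_id ?_
  · refine integrable_of_bounded (C := 2 * C) _ (measurable_semigroup_sub hf x _) fun t => ?_
    have := abs_semigroup_le Q hC t x
    exact (abs_sub _ _).trans (by linarith)
  · filter_upwards [Filter.eventually_ge_atTop 0] with T hT
    rw [intervalIntegral.integral_of_le hT]
    exact h.integral_Ioc_abs_sub_le hrate hsz hbal hf hC hT x

theorem integral_Ioi_abs_sub_le (x : S) :
    ∫ t in Ioi 0, |semigroup Q t f x - ∫ y, f y ∂P| ≤
      (2 * C + 1) * lyapunovIncrement a b 0 * (∫ y, (sz y : ℝ) ∂P + sz x) := by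
  have hi := (h.integrableOn_semigroup_sub hrate hsz hbal hf hC x).abs
  refine le_of_tendsto (intervalIntegral_tendsto_integral_Ioi 0 hi Filter.tendsto_id) ?_
  filter_upwards [Filter.eventually_ge_atTop 0] with T hT
  rw [id, intervalIntegral.integral_of_le hT]
  exact h.integral_Ioc_abs_sub_le hrate hsz hbal hf hC hT x

theorem abs_potential_le (x : S) :
    |potential Q P f x| ≤
      (2 * C + 1) * lyapunovIncrement a b 0 * (∫ y, (sz y : ℝ) ∂P + sz x) :=
  abs_integral_le_integral_abs.trans (h.integral_Ioi_abs_sub_le hrate hsz hbal hf hC x)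

/-- The time integral from each post-jump state is bounded linearly in its size, hence integrable
under the jump law. This licenses exchanging the jump mean with the time integral. -/
theorem integrable_prod_semigroup_sub (x : S) :
    Integrable (Function.uncurry fun z t => semigroup Q t f z - ∫ y, f y ∂P)
      ((jumpKernel Q x).prod (volume.restrict (Ioi 0))) := by
  have hm : Measurable fun p : S × ℝ => semigroup Q p.2 f p.1 - ∫ y, f y ∂P :=
    (Measurable.comp (g := fun p : ℝ × S => semigroup Q p.1 f p.2)
      (f := fun p : S × ℝ => (p.2, p.1)) (measurable_semigroup Q hf) (by fun_prop)).sub_const _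
  refine (integrable_prod_iff hm.aestronglyMeasurable).2
    ⟨ae_of_all _ fun z => h.integrableOn_semigroup_sub hrate hsz hbal hf hC z, ?_⟩
  refine (h.integrable_size x fun n =>
    (2 * C + 1) * lyapunovIncrement a b 0 * (∫ y, (sz y : ℝ) ∂P + n)).mono'
    hm.norm.stronglyMeasurable.integral_prod_right'.aestronglyMeasurable (ae_of_all _ fun z => ?_)
  rw [Real.norm_of_nonneg (integral_nonneg fun _ => norm_nonneg _)]
  exact h.integral_Ioi_abs_sub_le hrate hsz hbal hf hC z

theorem integrableOn_deriv_semigroup (x : S) :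
    IntegrableOn (fun t => totalRate a b β (sz x) *
      (∫ z, (semigroup Q t f z - ∫ y, f y ∂P) ∂jumpKernel Q x -
        (semigroup Q t f x - ∫ y, f y ∂P))) (Ioi 0) :=
  ((h.integrable_prod_semigroup_sub hrate hsz hbal hf hC x).integral_prod_right.sub
    (h.integrableOn_semigroup_sub hrate hsz hbal hf hC x)).const_mul _

/-- Convergence to equilibrium. -/
theorem tendsto_semigroup_sub (x : S) :
    Filter.Tendsto (fun t => semigroup Q t f x - ∫ y, f y ∂P) Filter.atTop (nhds 0) :=
  tendsto_zero_of_hasDerivAt_of_integrableOn_Ioi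
    (fun _ ht => h.hasDerivAt_semigroup_sub hf hC x ht)
    (h.integrableOn_deriv_semigroup hrate hsz hbal hf hC x)
    (h.integrableOn_semigroup_sub hrate hsz hbal hf hC x)

/-- The Poisson equation for the potential. -/
theorem totalRate_mul_potential (x : S) :
    totalRate a b β (sz x) * (∫ z, potential Q P f z ∂jumpKernel Q x - potential Q P f x) =
      -(f x - ∫ y, f y ∂P) := by
  have hprod := h.integrable_prod_semigroup_sub hrate hsz hbal hf hC x
  have hx := h.integrableOn_semigroup_sub hrate hsz hbal hf hC x
  have h1 := integral_Ioi_of_hasDerivAt_of_tendsto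
    (((h.continuousOn_semigroup hf hC x).sub continuousOn_const) 0 self_mem_Ici)
    (fun _ ht => h.hasDerivAt_semigroup_sub (P := P) hf hC x ht)
    (h.integrableOn_deriv_semigroup hrate hsz hbal hf hC x)
    (h.tendsto_semigroup_sub hrate hsz hbal hf hC x)
  have hk : IntegrableOn (fun t => ∫ z, (semigroup Q t f z - ∫ y, f y ∂P) ∂jumpKernel Q x)
      (Ioi 0) := hprod.integral_prod_right
  rw [integral_const_mul, integral_sub hk hx, ← integral_integral_swap hprod, Pi.sub_apply,
    h.semigroup_zero hf hC, zero_sub] at h1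
  exact h1

end IsBirthDeath

variable [IsProbabilityMeasure P]

theorem integral_semigroup_indicator {A : Set S} (hA : MeasurableSet A) (t : ℝ) :
    ENNReal.ofReal (∫ x, semigroup Q t (A.indicator 1) x ∂P) =
      ∫⁻ x, pathLaw Q x {ω | process Q t ω ∈ A} ∂P := by
  have h1 : ∀ x, semigroup Q t (A.indicator 1) x =
      (pathLaw Q x {ω | process Q t ω ∈ A}).toReal := fun x => by
    have : (fun ω => (A.indicator 1 (process Q t ω) : ℝ)) =
        (process Q t ⁻¹' A).indicator 1 := rfl
    rw [semigroup, this, integral_indicator_one (measurable_process_apply Q t hA)]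
    rfl
  have hm : Measurable fun x => pathLaw Q x {ω | process Q t ω ∈ A} :=
    (pathKernel Q).measurable_coe (measurable_process_apply Q t hA)
  simp only [h1]
  rw [integral_toReal hm.aemeasurable (ae_of_all _ fun x => measure_lt_top _ _),
    ENNReal.ofReal_toReal]
  refine ((lintegral_mono fun x => prob_le_one).trans_lt ?_).ne
  simp

namespace IsBirthDeath

variable (h : IsBirthDeath Q sz a b β) (hrate : Integrable (fun x => totalRate a b β (sz x)) P)
  (hbal : IsBalanced Q P)
include h hrate hbal

theorem isInvariantDistribution : IsInvariantDistribution Q P := by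
  refine ⟨inferInstance, fun t ht A hA => ?_⟩
  rw [← integral_semigroup_indicator hA, h.integral_semigroup_eq hrate hbal
    (measurable_one.indicator hA) (abs_indicator_one_le A) ht, integral_indicator_one hA,
    ofReal_measureReal]

/-- For indicators, the average of P_t f under `P'` is constant in time and, by dominated
convergence, tends to the mean under `P`. No moment assumption on `P'` is needed. -/
theorem eq_of_isInvariantDistribution (hsz : Integrable (fun x => (sz x : ℝ)) P) {P' : Measure S}
    (hP' : IsInvariantDistribution Q P') : P' = P := by
  have := hP'.1
  ext A hA
  have hf : Measurable (A.indicator 1 : S → ℝ) := measurable_one.indicator hA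
  have hC := abs_indicator_one_le A
  have hlim : Filter.Tendsto (fun t => ∫ x, (semigroup Q t (A.indicator 1) x -
      ∫ y, A.indicator 1 y ∂P) ∂P') Filter.atTop (nhds (∫ _, (0 : ℝ) ∂P')) := by
    refine tendsto_integral_filter_of_dominated_convergence (fun _ => 2)
      (Filter.Eventually.of_forall fun t =>
        ((measurable_semigroup_apply Q hf t).sub_const _).aestronglyMeasurable)
      (Filter.Eventually.of_forall fun t => ae_of_all _ fun x => ?_) (integrable_const _)
      (ae_of_all _ fun x => h.tendsto_semigroup_sub hrate hsz hbal hf hC x)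
    have h1 := abs_semigroup_le Q hC t x
    have h2 : |∫ y, (A.indicator 1 y : ℝ) ∂P| ≤ 1 := abs_integral_le_of_bounded _ hC
    exact (abs_sub _ _).trans (by linarith)
  have hconst : ∀ᶠ t in Filter.atTop, ∫ x, (semigroup Q t (A.indicator 1) x -
      ∫ y, A.indicator 1 y ∂P) ∂P' = P'.real A - P.real A := by
    filter_upwards [Filter.eventually_ge_atTop 0] with t ht
    rw [integral_sub (integrable_of_bounded _ (measurable_semigroup_apply Q hf t)
      (abs_semigroup_le Q hC t)) (integrable_const _), integral_indicator_one hA]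
    have h1 := integral_semigroup_indicator (Q := Q) (P := P') hA t
    rw [hP'.2 t ht A hA] at h1
    have h2 : 0 ≤ ∫ x, semigroup Q t (A.indicator 1) x ∂P' :=
      integral_nonneg fun x => integral_nonneg fun ω => indicator_nonneg (by simp) _
    have h3 : ∫ x, semigroup Q t (A.indicator 1) x ∂P' = P'.real A := by
      rw [Measure.real, ← h1, ENNReal.toReal_ofReal h2]
    simp [h3]
  have heq : P'.real A - P.real A = 0 := by
    refine tendsto_nhds_unique (tendsto_const_nhds.congr' (hconst.mono fun _ ht => ht.symm)) ?_
    simpa using hlim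
  exact (measureReal_eq_measureReal_iff (by simp) (by simp)).1 (sub_eq_zero.1 heq)

end IsBirthDeath

end Ergodic

/-! ### The generator and the Stein equation -/

section Generator

variable {Γ : Type*} [MeasurableSpace Γ] (μ : Measure Γ) [IsProbabilityMeasure μ] {a b β : ℝ}

/-- The generator in terms of the jump law. -/
theorem generator_eq (h : IsBirthDeath (systemRates a b β μ) Multiset.card a b β)
    {g : Multiset Γ → ℝ} (hg : Measurable g) (ξ : Multiset Γ)
    (hi : Integrable (fun x => g (x ::ₘ ξ)) μ) :
    generator a b β μ g ξ = totalRate a b β (Multiset.card ξ) *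
      (∫ η, g η ∂jumpKernel (systemRates a b β μ) ξ - g ξ) := by
  classical
  have hcons := measurable_cons_right ξ
  have hmap : Integrable g (μ.map fun x => x ::ₘ ξ) :=
    (integrable_map_measure hg.aestronglyMeasurable hcons.aemeasurable).2 hi
  obtain ⟨hdi, hd⟩ := integrable_deathMeasure_and_integral ξ hg
  have hQ : systemRates a b β μ ξ =
    ENNReal.ofReal (a + b * Multiset.card ξ) • μ.map (fun x => x ::ₘ ξ) +
    ENNReal.ofReal (1 + β * (Multiset.card ξ - 1)) • deathMeasure ξ := rfl
  -- On the empty configuration the coefficient 1 - β may be negative and be truncated by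
  -- `ENNReal.ofReal`, but the sum it multiplies is empty.
  have hmul : (ENNReal.ofReal (1 + β * (Multiset.card ξ - 1))).toReal *
      (ξ.map fun x => g (ξ.erase x)).sum =
      (1 + β * (Multiset.card ξ - 1)) * (ξ.map fun x => g (ξ.erase x)).sum := by
    rcases Nat.eq_zero_or_pos (Multiset.card ξ) with h0 | h0
    · simp [Multiset.card_eq_zero.1 h0]
    · have h1 : (1 : ℝ) ≤ Multiset.card ξ := by exact_mod_cast h0
      rw [ENNReal.toReal_ofReal (by nlinarith [h.nonneg_β])]
  rw [mul_sub, ← h.integral_rate ξ g, hQ, integral_add_measure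
    (hmap.smul_measure ENNReal.ofReal_ne_top) (hdi.smul_measure ENNReal.ofReal_ne_top),
    integral_smul_measure, integral_smul_measure, hd, smul_eq_mul, smul_eq_mul, hmul,
    ENNReal.toReal_ofReal (h.birthRate_pos _).le,
    integral_map hcons.aemeasurable hg.aestronglyMeasurable, generator,
    integral_sub hi (integrable_const _), Multiset.sum_map_sub, Multiset.map_const',
    Multiset.sum_replicate, totalRate]
  simp only [integral_const, probReal_univ, one_smul, nsmul_eq_mul]
  ring

end Generator

end PBDP

end

open PBDP in
theorem proposition2p1 {Γ : Type*} [MetricSpace Γ] [CompactSpace Γ] [MeasurableSpace Γ]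
    [BorelSpace Γ] (μ : Measure Γ) [IsProbabilityMeasure μ] (a b β : ℝ) (ha : 0 < a)
    (hb : 0 ≤ b) (hb1 : b < 1) (hβ : 0 ≤ β) :
    (∃! π : Measure ℕ, IsInvariantDistribution (birthDeathRates a b β) π) ∧
    ∀ π : Measure ℕ, IsInvariantDistribution (birthDeathRates a b β) π →
    ∀ f : Multiset Γ → ℝ, Measurable f → (∃ C : ℝ, ∀ ξ, |f ξ| ≤ C) →
      Integrable f (pointProcessLaw π μ) ∧
      (∀ ξ : Multiset Γ, ∀ t : ℝ, 0 ≤ t →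
        Integrable (fun ω => f (process (systemRates a b β μ) t ω))
          (pathLaw (systemRates a b β μ) ξ)) ∧
      (∀ ξ : Multiset Γ, IntegrableOn
        (fun t => expectation a b β μ f ξ t - ∫ η, f η ∂pointProcessLaw π μ) (Ioi 0)) ∧
      Measurable (steinSolution a b β μ (pointProcessLaw π μ) f) ∧
      ∀ ξ : Multiset Γ,
        Integrable (fun x => steinSolution a b β μ (pointProcessLaw π μ) f (x ::ₘ ξ)) μ ∧
        generator a b β μ (steinSolution a b β μ (pointProcessLaw π μ) f) ξ =
          f ξ - ∫ η, f η ∂pointProcessLaw π μ := by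
  have hN := isBirthDeath_birthDeathRates ha hb hb1 hβ
  have hprob := isProbabilityMeasure_stationary ha hb hβ hb1
  have hbalN := isBalanced_stationary ha hb hβ hb1
  have hrateN := integrable_totalRate_stationary ha hb hβ hb1
  have hszN := integrable_natCast_stationary ha hb hβ hb1
  have huniq : ∀ π, IsInvariantDistribution (birthDeathRates a b β) π → π = stationary a b β :=
    fun π hπ => hN.eq_of_isInvariantDistribution hrateN hbalN hszN hπ
  refine ⟨⟨stationary a b β, hN.isInvariantDistribution hrateN hbalN, huniq⟩, ?_⟩
  rintro π hπ f hf ⟨C, hC⟩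
  -- Uniqueness replaces an arbitrary invariant distribution by the explicit one, whose moments and
  -- balance are known.
  obtain rfl := huniq π hπ
  have h := isBirthDeath_systemRates μ ha hb hb1 hβ
  set P := pointProcessLaw (stationary a b β) μ with hP
  have hcard : P.map Multiset.card = stationary a b β := pointProcessLaw_map_card μ _
  have hbal : IsBalanced (systemRates a b β μ) P :=
    isBalanced_pointProcessLaw μ ha hb hb1 hβ hbalN
  have hrate : Integrable (fun ξ => totalRate a b β (Multiset.card ξ)) P := by
    rw [← hcard] at hrateN
    exact hrateN.comp_measurable measurable_card
  have hsz : Integrable (fun ξ => ((Multiset.card ξ : ℕ) : ℝ)) P := by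
    rw [← hcard] at hszN
    exact hszN.comp_measurable measurable_card
  have hsol : steinSolution a b β μ P f = fun ξ => -potential (systemRates a b β μ) P f ξ := rfl
  have hmeas : Measurable (steinSolution a b β μ P f) := by
    rw [hsol]
    exact (measurable_potential hf).neg
  refine ⟨integrable_of_bounded _ hf hC, fun ξ t _ =>
    integrable_of_bounded _ (measurable_comp_process _ hf t) fun _ => hC _,
    fun ξ => h.integrableOn_semigroup_sub hrate hsz hbal hf hC ξ, hmeas, fun ξ => ?_⟩
  -- The potential is bounded in terms of the size alone, and adding a point always gives size |ξ| +
  -- 1, so the function of `x` is bounded.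
  have hint : Integrable (fun x => steinSolution a b β μ P f (x ::ₘ ξ)) μ := by
    refine integrable_of_bounded (C := (2 * C + 1) * lyapunovIncrement a b 0 *
      (∫ η, ((Multiset.card η : ℕ) : ℝ) ∂P + (Multiset.card ξ + 1 : ℕ))) _
      (hmeas.comp (measurable_cons_right ξ)) fun x => ?_
    rw [hsol, ← Multiset.card_cons x ξ]
    dsimp only
    rw [abs_neg]
    exact h.abs_potential_le hrate hsz hbal hf hC (x ::ₘ ξ)
  refine ⟨hint, ?_⟩
  rw [generator_eq μ h hmeas ξ hint, hsol, integral_neg]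
  have := h.totalRate_mul_potential hrate hsz hbal hf hC ξ
  linarith
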